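/- Let $T\colon[-1,1]\to[-1,1]$ be an analytic full-branch map: $[-1,1]=\bigcup_{\ell=1}^d I_\ell$ with closed intervals $I_\ell$ with non-empty, pairwise disjoint interiors, $T|_{\operatorname{int} I_\ell}$ is an analytic diffeomorphism onto its image, and $\overline{T(I_\ell)}=[-1,1]$ for each $\ell$. For $s>0$ let $D_s=\{z\in\mathbb C:|z|<s\}$. Suppose that for some $1<r<R$ the inverse branches $\varphi_\ell\colon[-1,1]\to I_\ell$ extend holomorphically to $D_R$ with $\varphi_\ell(D_R)\subseteq D_r$. Put $\gamma=(1+\sqrt2)^2$, assume $r/R<1/\gamma$, and let $\rho=\sqrt{rR/\gamma}$. Let $H^2(D_\rho)$ be the Hardy space of holomorphic $f$ on $D_\rho$ with $\|f\|^2=\sup_{s<\rho}\frac1{2\pi}\int_0^{2\pi}|f(se^{it})|^2\,dt<\infty$, with inner product $(f,g)=\lim_{s\uparrow\rho}\frac1{2\pi}\int_0^{2\pi}f(se^{it})\overline{g(se^{it})}\,dt$ and orthonormal basis $e_n(z)=(z/\rho)^n$, $n\ge 0$. Then the transfer operator $$(\mathcal L f)(z)=\sum_{\ell=1}^d\operatorname{sgn}(\varphi_\ell'(0))\,\varphi_\ell'(z)\,f(\varphi_\ell(z))$$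 is bounded on $H^2(D_\rho)$, and its matrix $L_{kl}=(\mathcal L e_l,e_k)$ defines a bounded operator $L$ on $\ell^2(\mathbb N_0)$. For $N\ge0$, $M\ge1$ and $0\le\delta\le 2/M$ let $x_m=-1+\delta+2m/M$ $(0\le m<M)$, and for $0\le k,l<N$ let $$\big(\hat H_N^{(M)}\big)_{kl}=\frac1M\sum_{m=0}^{M-1}x_m^k x_m^l,\qquad \big(\hat G_N^{(M)}\big)_{kl}=\frac1M\sum_{m=0}^{M-1}T(x_m)^k x_m^l .$$ Let $G_N^{(M)}$, $(H_N^{(M)})^\dagger$, $V_N$, $V_N^{-1}$ be the operators on $\ell^2(\mathbb N_0)$ whose upper left $N\times N$ section is $\hat G_N^{(M)}$, $(\hat H_N^{(M)})^{-1}$, $\operatorname{diag}(\rho^n)_{0\le n<N}$, $\operatorname{diag}(\rho^{-n})_{0\le n<N}$, respectively, and whose other entries are zero. Then there are constants $C_1,C_2>0$ such that for all $N\ge0$, all $M\ge1$ with $M\ge C_1N^2\gamma^N$, and all $\delta\in[0,2/M]$, the matrix $\hat H_N^{(M)}$ is invertible and $$\big\|V_N(H_N^{(M)})^\dagger G_N^{(M)}V_N^{-1}-L\big\|_{\ell^2\to\ell^2}\le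 C_2\left(\frac{(\gamma rR)^{N/2}N^2}{M}+\Big(\frac{\gamma r}{R}\Big)^{N/2}\right).$$ -/

import Mathlib

noncomputable section

namespace EDMD

/-- `T` is a full branch map of `[-1, 1]` with the finitely many branch domains
`[a ℓ, b ℓ]`. At the end points of the branch domains the values of `T` are arbitrary elements of
`[-1, 1]`. -/
structure IsFullBranchMap {d : ℕ} (T : ℝ → ℝ) (a b : Fin d → ℝ) : Prop where
  mapsTo : Set.MapsTo T (Set.Icc (-1) 1) (Set.Icc (-1) 1)
  lt : ∀ ℓ, a ℓ < b ℓ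
  cover : Set.Icc (-1 : ℝ) 1 = ⋃ ℓ, Set.Icc (a ℓ) (b ℓ)
  disjoint : ∀ i j, i ≠ j → Disjoint (Set.Ioo (a i) (b i)) (Set.Ioo (a j) (b j))
  analytic : ∀ ℓ, AnalyticOnNhd ℝ T (Set.Ioo (a ℓ) (b ℓ))
  injOn : ∀ ℓ, Set.InjOn T (Set.Ioo (a ℓ) (b ℓ))
  deriv_ne_zero : ∀ ℓ, ∀ x ∈ Set.Ioo (a ℓ) (b ℓ), deriv T x ≠ 0
  full : ∀ ℓ, closure (T '' Set.Icc (a ℓ) (b ℓ)) = Set.Icc (-1) 1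

/-- The functions `φ ℓ` are holomorphic on the disk `D_R`, map it into `D_r` (in particular they are
bounded on `D_R`), and extend the inverse branches of `T`: on `(-1, 1)`, which is the image under
`T` of each `(a ℓ, b ℓ)`, and hence, by continuity, on `[-1, 1]` when `1 < R`. -/
structure ExtendsInverseBranches {d : ℕ} (T : ℝ → ℝ) (a b : Fin d → ℝ) (φ : Fin d → ℂ → ℂ)
    (r R : ℝ) : Prop where
  holo : ∀ ℓ, DifferentiableOn ℂ (φ ℓ) (Metric.ball 0 R)
  mapsTo : ∀ ℓ, Set.MapsTo (φ ℓ) (Metric.ball 0 R) (Metric.ball 0 r)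
  inverse : ∀ ℓ, ∀ x ∈ Set.Ioo (a ℓ) (b ℓ), φ ℓ (T x : ℂ) = (x : ℂ)

/-- The transfer operator `(𝓛 f)(z) = ∑ σ_ℓ φ_ℓ'(z) f(φ_ℓ(z))`, `σ_ℓ = sgn φ_ℓ'(0)`
(`φ_ℓ` is real on the interval `(-1, 1)`, hence so is `φ_ℓ'(0)`). -/
def transfer {d : ℕ} (φ : Fin d → ℂ → ℂ) (f : ℂ → ℂ) (z : ℂ) : ℂ :=
  ∑ ℓ, ((Real.sign (deriv (φ ℓ) 0).re : ℝ) : ℂ) * deriv (φ ℓ) z * f (φ ℓ z)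

/-- The mean of `|f|^2` over the circle of radius `s`. -/
def circleMeanSq (f : ℂ → ℂ) (s : ℝ) : ℝ :=
  (1 / (2 * Real.pi)) * ∫ t in (0 : ℝ)..(2 * Real.pi), ‖f (s * Complex.exp (Complex.I * t))‖ ^ 2

/-- `f` belongs to the Hardy space `H²(D_ρ)`; only the values of `f` on `D_ρ` matter. -/
def MemHardy (ρ : ℝ) (f : ℂ → ℂ) : Prop :=
  DifferentiableOn ℂ f (Metric.ball 0 ρ) ∧ BddAbove (circleMeanSq f '' Set.Ico 0 ρ)

/-- The norm of `H²(D_ρ)`. -/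
def hardyNorm (ρ : ℝ) (f : ℂ → ℂ) : ℝ :=
  sSup ((fun s => √(circleMeanSq f s)) '' Set.Ico 0 ρ)

/-- The inner product `(f, g)` of `H²(D_ρ)` exists as a limit of circle means and equals `c`. -/
def HasHardyInner (ρ : ℝ) (f g : ℂ → ℂ) (c : ℂ) : Prop :=
  Filter.Tendsto
    (fun s : ℝ => (1 / (2 * Real.pi) : ℂ) * ∫ t in (0 : ℝ)..(2 * Real.pi),
      f (s * Complex.exp (Complex.I * t)) *
        (starRingEnd ℂ) (g (s * Complex.exp (Complex.I * t))))
    (nhdsWithin ρ (Set.Iio ρ)) (nhds c)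

/-- The orthonormal basis `e_n(z) = (z / ρ)^n` of `H²(D_ρ)`. -/
def hardyBasis (ρ : ℝ) (n : ℕ) (z : ℂ) : ℂ := (z / ρ) ^ n

/-- The Hilbert space `ℓ²(ℕ₀)`. -/
abbrev Ell2 : Type := lp (fun _ : ℕ => ℂ) 2

/-- The standard unit vectors of `ℓ²(ℕ₀)`. -/
def unitVec (n : ℕ) : Ell2 := lp.single 2 n (1 : ℂ)

/-- The transfer operator is a bounded operator on `H²(D_ρ)`, and the bounded operator `L` on
`ℓ²(ℕ₀)` is its matrix with respect to the basis `hardyBasis ρ`, that is,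
`L_{kl} = (𝓛 e_l, e_k)`. Such an `L` is unique. -/
structure IsTransferMatrix {d : ℕ} (φ : Fin d → ℂ → ℂ) (ρ : ℝ) (L : Ell2 →L[ℂ] Ell2) : Prop where
  bounded : ∃ K : ℝ, ∀ f, MemHardy ρ f →
    MemHardy ρ (transfer φ f) ∧ hardyNorm ρ (transfer φ f) ≤ K * hardyNorm ρ f
  entry : ∀ k l : ℕ,
    HasHardyInner ρ (transfer φ (hardyBasis ρ l)) (hardyBasis ρ k) (L (unitVec l) k)

/-- The operator of rank at most `N` on `ℓ²(ℕ₀)` whose upper left `N × N` section is `A` and which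
vanishes elsewhere. -/
def lift {N : ℕ} (A : Matrix (Fin N) (Fin N) ℂ) : Ell2 →L[ℂ] Ell2 :=
  ∑ i : Fin N, ∑ j : Fin N, A i j • (innerSL ℂ (unitVec j)).smulRight (unitVec i)

/-- The equidistant nodes `x_m = -1 + δ + 2m/M`. -/
def node (M : ℕ) (δ : ℝ) (m : ℕ) : ℝ := -1 + δ + 2 * (m : ℝ) / (M : ℝ)

/-- The matrix `H` of EDMD for `N` monomials and `M` equidistant nodes. -/
def matH (N M : ℕ) (δ : ℝ) : Matrix (Fin N) (Fin N) ℂ := fun k l =>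
  (((1 / (M : ℝ)) * ∑ m ∈ Finset.range M,
    node M δ m ^ (k : ℕ) * node M δ m ^ (l : ℕ) : ℝ) : ℂ)

/-- The matrix `G` of EDMD for `N` monomials and `M` equidistant nodes. -/
def matG (T : ℝ → ℝ) (N M : ℕ) (δ : ℝ) : Matrix (Fin N) (Fin N) ℂ := fun k l =>
  (((1 / (M : ℝ)) * ∑ m ∈ Finset.range M,
    T (node M δ m) ^ (k : ℕ) * node M δ m ^ (l : ℕ) : ℝ) : ℂ)

/-- `V_N`, the `N × N` section of the diagonal operator with entries `ρ^n`. -/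
def opV (ρ : ℝ) (N : ℕ) : Ell2 →L[ℂ] Ell2 :=
  lift (Matrix.diagonal fun n : Fin N => (ρ : ℂ) ^ (n : ℕ))

/-- `V_N⁻¹`, the `N × N` section of the diagonal operator with entries `ρ^{-n}`. -/
def opVinv (ρ : ℝ) (N : ℕ) : Ell2 →L[ℂ] Ell2 :=
  lift (Matrix.diagonal fun n : Fin N => ((ρ : ℂ) ^ (n : ℕ))⁻¹)

/-- The rescaled EDMD operator `V_N (H_N^{(M)})^† G_N^{(M)} V_N⁻¹` on `ℓ²(ℕ₀)`, where
`(H_N^{(M)})^†` is the lift of the inverse of the `N × N` matrix. -/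
def rescaledEDMD (T : ℝ → ℝ) (ρ : ℝ) (N M : ℕ) (δ : ℝ) : Ell2 →L[ℂ] Ell2 :=
  opV ρ N ∘L lift (matH N M δ)⁻¹ ∘L lift (matG T N M δ) ∘L opVinv ρ N

/-- `γ = (1 + √2)²`. -/
def gam : ℝ := (1 + √2) ^ 2

end EDMD

end

/-!
The transfer operator `𝓛` is the adjoint of the composition with `T`, so that
`½ ∫ T(x) ^ j x ^ l dx = ½ ∫ y ^ j (𝓛 x ^ l)(y) dy`
(`ExtendsInverseBranches.integral_pow_mul_transfer`). Hence, as `M → ∞`, the columns of `H⁻¹ G` tend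
to the coefficients of the `L²(-1, 1)`-projections of `𝓛 x ^ l` onto the polynomials of degree less
than `N`, and these are close to the Taylor coefficients of `𝓛 x ^ l`, the entries of the matrix of
`𝓛`.

* Analyticity. Since `𝓛` maps functions bounded on `D_r` to functions bounded on every disk
  `D_s` with `s < R`, the matrix of `𝓛` with respect to `e_n = (z / ρ) ^ n` has entries of size
  `(ρ / s) ^ k (r / ρ) ^ l`. It therefore defines a bounded operator whose sections converge
  geometrically (`exists_operator_of_geometric_decay`). The choice `s = R / √γ > ρ` makes both rates
  at most `√(γ r / R)` (`radii_relations`).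
* Conditioning. A polynomial `p = ∑ u_k x ^ k` of degree less than `N` satisfies
  `∑ |u_k| ^ 2 ≤ γ ^ N · ½ ∫ |p| ^ 2` (`sum_norm_coeff_sq_le`): expand it in the Chebyshev
  polynomials `U_k`, whose coefficients have `ℓ¹` norm at most `(1 + √2) ^ k`. So the matrix of moments has an
  inverse of norm at most `γ ^ N`.
* Discretization. `T` is of bounded variation, so the entries of `H` and `G` differ from their
  limits by `O(N / M)` (`norm_matH_sub_moment_le`, `IsFullBranchMap.exists_norm_matG_sub_le`). For
  `M ≥ 8 N ^ 2 γ ^ N` this perturbation leaves at least half of the quadratic form of the moments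
  (`polyNormSq_le`), and `H` is invertible.

Let `c_l` be the first `N` Taylor coefficients of `𝓛 e_l` and `g_l` the `l`-th column of `G V⁻¹`.
Then `H (H⁻¹ g_l - c_l)` is the sum of the moments of the Taylor remainder of `𝓛 e_l` and of the
discretization error. The latter is amplified by `ρ ^ N γ ^ N` (`sum_norm_sq_le_of_mulVec_eq`),
which gives the first term of the estimate. The former is amplified only by `ρ ^ N γ ^ (N / 2)`, because
solving with the moments of a function is nearly an orthogonal projection in `L²(-1, 1)`
(`sum_norm_sq_le_of_mulVec_eq_integral`); as the remainder is of size `s ^ (-N)`, this gives the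
second term. The bounds decay geometrically in `l`, so it suffices to add up the norms of the columns.
-/

/-! ### Chebyshev polynomials of the second kind and the conditioning of monomials -/

noncomputable section

namespace EDMD

open Polynomial MeasureTheory
open scoped Real

lemma gam_eq : gam = 3 + 2 * √2 := by
  rw [gam]; nlinarith [Real.sq_sqrt (show (0 : ℝ) ≤ 2 by norm_num)]

lemma gam_gt_five : 5 < gam := by
  have : (1 : ℝ) < √2 := by rw [Real.lt_sqrt] <;> norm_num
  rw [gam_eq]; linarith

/-- The `ℓ¹` norm of the coefficients of `U_k` is at most `(1 + √2) ^ k`. -/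
lemma sum_norm_coeff_chebyshevU_le (n k : ℕ) :
    ∑ i ∈ Finset.range n, ‖(Chebyshev.U ℂ k).coeff i‖ ≤ (1 + √2) ^ k := by
  induction k using Nat.twoStepInduction generalizing n with
  | zero =>
    simp only [Nat.cast_zero, Chebyshev.U_zero, coeff_one, pow_zero]
    calc ∑ i ∈ Finset.range n, ‖(if i = 0 then (1 : ℂ) else 0)‖
        = ∑ i ∈ Finset.range n, (if i = 0 then (1 : ℝ) else 0) :=
          Finset.sum_congr rfl fun i _ => by split_ifs <;> simp
      _ ≤ 1 := by rw [Finset.sum_ite_eq']; split_ifs <;> norm_num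
  | one =>
    have h2 : (1 : ℝ) < √2 := by rw [Real.lt_sqrt] <;> norm_num
    simp only [Nat.cast_one, Chebyshev.U_one, pow_one]
    calc ∑ i ∈ Finset.range n, ‖(2 * X : ℂ[X]).coeff i‖
        = ∑ i ∈ Finset.range n, (if i = 1 then (2 : ℝ) else 0) :=
          Finset.sum_congr rfl fun i _ => by
            rw [show (2 : ℂ[X]) = C 2 from rfl, coeff_C_mul, coeff_X]
            by_cases h : i = 1
            · simp [h]
            · simp [h, Ne.symm h]
      _ ≤ 1 + √2 := by rw [Finset.sum_ite_eq']; split_ifs <;> linarith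
  | more k ih ih' =>
    have hU : Chebyshev.U ℂ ((k + 2 : ℕ) : ℤ) =
        C 2 * (X * Chebyshev.U ℂ ((k + 1 : ℕ) : ℤ)) - Chebyshev.U ℂ (k : ℤ) := by
      push_cast
      rw [Chebyshev.U_add_two, mul_assoc]; rfl
    have hX : ∑ i ∈ Finset.range n, ‖(X * Chebyshev.U ℂ ((k + 1 : ℕ) : ℤ)).coeff i‖
        ≤ (1 + √2) ^ (k + 1) := by
      cases n with
      | zero => simp; positivity
      | succ n =>
        rw [Finset.sum_range_succ']
        simpa [coeff_X_mul] using ih' n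
    calc ∑ i ∈ Finset.range n, ‖(Chebyshev.U ℂ ((k + 2 : ℕ) : ℤ)).coeff i‖
        ≤ ∑ i ∈ Finset.range n, (2 * ‖(X * Chebyshev.U ℂ ((k + 1 : ℕ) : ℤ)).coeff i‖
            + ‖(Chebyshev.U ℂ (k : ℤ)).coeff i‖) := by
          refine Finset.sum_le_sum fun i _ => ?_
          rw [hU, coeff_sub, coeff_C_mul]
          refine (norm_sub_le _ _).trans ?_
          simp
      _ ≤ 2 * (1 + √2) ^ (k + 1) + (1 + √2) ^ k := by
          rw [Finset.sum_add_distrib, ← Finset.mul_sum]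
          linarith [hX, ih n]
      _ = (1 + √2) ^ (k + 2) := by
          have : √2 * √2 = 2 := Real.mul_self_sqrt (by norm_num)
          linear_combination (-(1 + √2) ^ k) * this

/-- A polynomial of degree less than `N` is a combination of the first `N` Chebyshev polynomials
of the second kind. -/
lemma exists_eq_sum_chebyshevU (N : ℕ) (p : ℂ[X]) (hp : p.degree < N) :
    ∃ a : ℕ → ℂ, p = ∑ k ∈ Finset.range N, C (a k) * Chebyshev.U ℂ k := by
  induction N generalizing p with
  | zero => exact ⟨0, by simpa using hp⟩
  | succ N ih =>
    have hU : (Chebyshev.U ℂ N).degree = N := Chebyshev.degree_U_natCast ℂ N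
    set l := (Chebyshev.U ℂ N).leadingCoeff with hl
    have hl0 : l ≠ 0 := by
      rw [hl, Ne, leadingCoeff_eq_zero]
      intro h; rw [h] at hU; simp at hU
    have hlc : (Chebyshev.U ℂ N).coeff N = l := by
      rw [hl, leadingCoeff, natDegree_eq_of_degree_eq_some hU]
    have hq : (p - C (p.coeff N / l) * Chebyshev.U ℂ N).degree < N := by
      rw [degree_lt_iff_coeff_zero] at hp ⊢
      intro m hm
      rcases hm.eq_or_lt with rfl | hm
      · rw [coeff_sub, coeff_C_mul, hlc, div_mul_cancel₀ _ hl0, sub_self]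
      · rw [coeff_sub, coeff_C_mul, hp m hm, coeff_eq_zero_of_degree_lt
          (p := Chebyshev.U ℂ N) (by rw [hU]; exact_mod_cast hm)]
        simp
    obtain ⟨a, ha⟩ := ih _ hq
    refine ⟨Function.update a N (p.coeff N / l), ?_⟩
    rw [Finset.sum_range_succ, Function.update_self, ← sub_eq_iff_eq_add, ha]
    refine Finset.sum_congr rfl fun k hk => ?_
    rw [Function.update_of_ne (Finset.mem_range.mp hk).ne]

lemma integral_sin_mul_sin (j k : ℕ) :
    ∫ θ in (0 : ℝ)..π, Real.sin ((j + 1) * θ) * Real.sin ((k + 1) * θ)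
      = if j = k then π / 2 else 0 := by
  have hcos : ∀ m : ℤ, ∫ θ in (0 : ℝ)..π, Real.cos (m * θ) = if m = 0 then π else 0 := by
    intro m
    split_ifs with h
    · simp [h]
    · have hm : (m : ℝ) ≠ 0 := by exact_mod_cast h
      rw [intervalIntegral.integral_comp_mul_left _ hm]
      simp [Real.sin_int_mul_pi]
  have h1 : ∀ θ : ℝ, Real.sin ((j + 1) * θ) * Real.sin ((k + 1) * θ) =
      (Real.cos (((j - k : ℤ) : ℝ) * θ) - Real.cos (((j + k + 2 : ℤ) : ℝ) * θ)) / 2 := by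
    intro θ
    have e1 : (((j - k : ℤ) : ℝ) * θ) = (j + 1) * θ - (k + 1) * θ := by push_cast; ring
    have e2 : (((j + k + 2 : ℤ) : ℝ) * θ) = (j + 1) * θ + (k + 1) * θ := by push_cast; ring
    rw [e1, e2, Real.cos_sub, Real.cos_add]; ring
  simp_rw [h1]
  rw [intervalIntegral.integral_div, intervalIntegral.integral_sub, hcos, hcos]
  · have h3 : ((j : ℤ) + k + 2) ≠ 0 := by positivity
    rw [if_neg h3]
    by_cases h : j = k
    · simp [h]
    · rw [if_neg h, if_neg (by omega)]; simp
  all_goals exact (by fun_prop : Continuous _).intervalIntegrable _ _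

/-- Parseval's identity for sine polynomials. -/
lemma integral_normSq_sum_sin (N : ℕ) (a : ℕ → ℂ) :
    ∫ θ in (0 : ℝ)..π, ‖∑ k ∈ Finset.range N, a k * (Real.sin ((k + 1) * θ) : ℂ)‖ ^ 2
      = π / 2 * ∑ k ∈ Finset.range N, ‖a k‖ ^ 2 := by
  have h1 : ∀ θ : ℝ, ‖∑ k ∈ Finset.range N, a k * (Real.sin ((k + 1) * θ) : ℂ)‖ ^ 2 =
      ∑ j ∈ Finset.range N, ∑ k ∈ Finset.range N, (a j * (starRingEnd ℂ) (a k)).re *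
        (Real.sin ((j + 1) * θ) * Real.sin ((k + 1) * θ)) := by
    intro θ
    have := Complex.mul_conj (∑ k ∈ Finset.range N, a k * (Real.sin ((k + 1) * θ) : ℂ))
    rw [Complex.normSq_eq_norm_sq] at this
    rw [← Complex.ofReal_re (_ ^ 2), ← this, map_sum, Finset.sum_mul_sum, Complex.re_sum]
    refine Finset.sum_congr rfl fun j _ => ?_
    rw [Complex.re_sum]
    refine Finset.sum_congr rfl fun k _ => ?_
    rw [map_mul, Complex.conj_ofReal, ← Complex.re_mul_ofReal]
    congr 1
    push_cast
    ring
  simp_rw [h1]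
  rw [intervalIntegral.integral_finsetSum]
  · rw [Finset.mul_sum]
    refine Finset.sum_congr rfl fun j hj => ?_
    rw [intervalIntegral.integral_finsetSum]
    · simp_rw [intervalIntegral.integral_const_mul, integral_sin_mul_sin]
      simp only [mul_ite, mul_zero]
      rw [Finset.sum_ite_eq, if_pos hj, Complex.mul_conj, Complex.ofReal_re,
        Complex.normSq_eq_norm_sq]
      ring
    · intro k _
      exact (by fun_prop : Continuous _).intervalIntegrable _ _
  · intro j _
    exact (by fun_prop : Continuous _).intervalIntegrable _ _

/-- The monomials of degree less than `N` form a basis whose condition with respect to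
`L²(-1, 1)` is controlled by `gam ^ N`: a lower bound for the smallest eigenvalue of the Hankel
matrix of the moments of `[-1, 1]`. The weight `sin θ` of the substitution `x = cos θ` is bounded
below by the weight `sin² θ` for which the polynomials `U_k` are orthogonal. -/
lemma sum_norm_coeff_sq_le (N : ℕ) (p : ℂ[X]) (hp : p.degree < N) :
    ∑ i ∈ Finset.range N, ‖p.coeff i‖ ^ 2
      ≤ gam ^ N * ((1 / 2) * ∫ x in (-1 : ℝ)..1, ‖p.eval (x : ℂ)‖ ^ 2) := by
  obtain ⟨a, ha⟩ := exists_eq_sum_chebyshevU N p hp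
  have hg := gam_gt_five
  -- substitution `x = cos θ`
  have hsub : ∫ x in (-1 : ℝ)..1, ‖p.eval (x : ℂ)‖ ^ 2 =
      ∫ θ in (0 : ℝ)..π, ‖p.eval (Real.cos θ : ℂ)‖ ^ 2 * Real.sin θ := by
    have := intervalIntegral.integral_comp_mul_deriv (a := 0) (b := π) (f := Real.cos)
      (f' := fun x => - Real.sin x) (g := fun x : ℝ => ‖p.eval (x : ℂ)‖ ^ 2)
      (fun x _ => Real.hasDerivAt_cos x) (by fun_prop) (by fun_prop)
    simp only [Real.cos_zero, Real.cos_pi, Function.comp_apply, mul_neg,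
      intervalIntegral.integral_neg] at this
    rw [intervalIntegral.integral_symm, ← this, neg_neg]
  have hle : π / 2 * ∑ k ∈ Finset.range N, ‖a k‖ ^ 2 ≤
      ∫ x in (-1 : ℝ)..1, ‖p.eval (x : ℂ)‖ ^ 2 := by
    rw [← integral_normSq_sum_sin, hsub]
    refine intervalIntegral.integral_mono_on Real.pi_pos.le
      ((by fun_prop : Continuous _).intervalIntegrable _ _)
      ((by fun_prop : Continuous _).intervalIntegrable _ _) fun θ hθ => ?_
    have h0 : 0 ≤ Real.sin θ := Real.sin_nonneg_of_mem_Icc hθ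
    have : ∑ k ∈ Finset.range N, a k * (Real.sin ((k + 1) * θ) : ℂ)
        = p.eval (Real.cos θ : ℂ) * Real.sin θ := by
      conv_rhs => rw [ha]
      rw [eval_finsetSum, Finset.sum_mul]
      refine Finset.sum_congr rfl fun k _ => ?_
      rw [eval_mul, eval_C, mul_assoc]
      push_cast
      rw [Chebyshev.U_complex_cos]
      push_cast
      rfl
    rw [this, norm_mul, mul_pow, Complex.norm_real, Real.norm_eq_abs, sq_abs]
    refine mul_le_mul_of_nonneg_left ?_ (by positivity)
    nlinarith [Real.sin_le_one θ]
  have hcoef : ∑ i ∈ Finset.range N, ‖p.coeff i‖ ≤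
      ∑ k ∈ Finset.range N, ‖a k‖ * (1 + √2) ^ k := by
    calc ∑ i ∈ Finset.range N, ‖p.coeff i‖
        ≤ ∑ i ∈ Finset.range N, ∑ k ∈ Finset.range N, ‖a k‖ * ‖(Chebyshev.U ℂ k).coeff i‖ := by
          refine Finset.sum_le_sum fun i _ => ?_
          conv_lhs => rw [ha]
          rw [finsetSum_coeff]
          refine (norm_sum_le _ _).trans (Finset.sum_le_sum fun k _ => ?_)
          rw [coeff_C_mul, norm_mul]
      _ ≤ _ := by
          rw [Finset.sum_comm]
          refine Finset.sum_le_sum fun k _ => ?_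
          rw [← Finset.mul_sum]
          exact mul_le_mul_of_nonneg_left (sum_norm_coeff_chebyshevU_le N k) (norm_nonneg _)
  have hgeom : ∑ k ∈ Finset.range N, ((1 + √2) ^ k) ^ 2 ≤ (1 / 4) * gam ^ N := by
    have : ∀ k : ℕ, ((1 + √2) ^ k) ^ 2 = gam ^ k := fun k => by
      rw [gam, ← pow_mul, ← pow_mul, mul_comm]
    simp_rw [this]
    rw [geom_sum_eq (by linarith), div_le_iff₀ (by linarith)]
    have : 0 < gam ^ N := by positivity
    nlinarith
  have hI : 0 ≤ ∑ k ∈ Finset.range N, ‖a k‖ ^ 2 := by positivity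
  calc ∑ i ∈ Finset.range N, ‖p.coeff i‖ ^ 2
      ≤ (∑ i ∈ Finset.range N, ‖p.coeff i‖) ^ 2 :=
        Finset.sum_sq_le_sq_sum_of_nonneg fun i _ => norm_nonneg _
    _ ≤ (∑ k ∈ Finset.range N, ‖a k‖ * (1 + √2) ^ k) ^ 2 := by gcongr
    _ ≤ (∑ k ∈ Finset.range N, ‖a k‖ ^ 2) * ∑ k ∈ Finset.range N, ((1 + √2) ^ k) ^ 2 :=
        Finset.sum_mul_sq_le_sq_mul_sq _ _ _
    _ ≤ (∑ k ∈ Finset.range N, ‖a k‖ ^ 2) * ((1 / 4) * gam ^ N) := by gcongr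
    _ ≤ gam ^ N * ((1 / 2) * ∫ x in (-1 : ℝ)..1, ‖p.eval (x : ℂ)‖ ^ 2) := by
        have h3 := Real.pi_gt_three
        have : (∑ k ∈ Finset.range N, ‖a k‖ ^ 2) * (1 / 4) ≤
            (1 / 2) * ∫ x in (-1 : ℝ)..1, ‖p.eval (x : ℂ)‖ ^ 2 := by nlinarith
        have hgp : 0 < gam ^ N := by positivity
        nlinarith

end EDMD
end

/-! ### Riemann sums -/

noncomputable section

namespace EDMD

open MeasureTheory

lemma node_mem {M : ℕ} {δ : ℝ} (h0 : 0 ≤ δ) (hδ : δ ≤ 2 / (M : ℝ)) (m : ℕ) :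
    -1 + 2 * (m : ℝ) / M ≤ node M δ m ∧ node M δ m ≤ -1 + 2 * ((m + 1 : ℕ) : ℝ) / M := by
  have : 2 * ((m + 1 : ℕ) : ℝ) / M = 2 * (m : ℝ) / M + 2 / M := by push_cast; ring
  rw [node, this]
  constructor <;> linarith

/-- A Riemann sum with one node in each of `M` equal cells differs from the integral by at most the
total oscillation divided by `M`; the increments of `w` dominate those of `g`. -/
lemma abs_riemannSum_sub_integral_le {g w : ℝ → ℝ} {M : ℕ} (hM : 0 < M) {δ : ℝ} (h0 : 0 ≤ δ)
    (hδ : δ ≤ 2 / (M : ℝ)) (hg : IntervalIntegrable g volume (-1) 1)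
    (hw : ∀ x y, -1 ≤ x → x ≤ y → y ≤ 1 → |g y - g x| ≤ w y - w x) :
    |(1 / (M : ℝ)) * ∑ m ∈ Finset.range M, g (node M δ m) - (1 / 2) * ∫ x in (-1 : ℝ)..1, g x|
      ≤ (w 1 - w (-1)) / M := by
  have hM' : (0 : ℝ) < M := by exact_mod_cast hM
  set t : ℕ → ℝ := fun m => -1 + 2 * (m : ℝ) / M with ht
  have ht0 : t 0 = -1 := by simp [ht]
  have htM : t M = 1 := by simp only [ht]; field_simp; norm_num
  have hstep : ∀ m, t (m + 1) - t m = 2 / M := fun m => by simp only [ht]; push_cast; ring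
  have htmono : Monotone t := monotone_nat_of_le_succ fun m => by
    have := hstep m
    have : 0 < 2 / (M : ℝ) := by positivity
    linarith
  have hlo : ∀ m, -1 ≤ t m := fun m => ht0 ▸ htmono (Nat.zero_le m)
  have hhi : ∀ m, m ≤ M → t m ≤ 1 := fun m hm => htM ▸ htmono hm
  have hwmono : ∀ x y, -1 ≤ x → x ≤ y → y ≤ 1 → w x ≤ w y := fun x y h1 h2 h3 => by
    linarith [hw x y h1 h2 h3, abs_nonneg (g y - g x)]
  have hint : ∀ m < M, IntervalIntegrable g volume (t m) (t (m + 1)) := fun m hm =>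
    hg.mono_set <| by
      rw [Set.uIcc_of_le (htmono m.le_succ), Set.uIcc_of_le (by norm_num)]
      exact Set.Icc_subset_Icc (hlo m) (hhi _ hm)
  have hsum : ∫ x in (-1 : ℝ)..1, g x = ∑ m ∈ Finset.range M, ∫ x in (t m)..(t (m + 1)), g x := by
    rw [intervalIntegral.sum_integral_adjacent_intervals hint, ht0, htM]
  have hcell : ∀ m ∈ Finset.range M,
      |(1 / (M : ℝ)) * g (node M δ m) - (1 / 2) * ∫ x in (t m)..(t (m + 1)), g x|
        ≤ (w (t (m + 1)) - w (t m)) / M := by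
    intro m hm
    have hm' := Finset.mem_range.mp hm
    obtain ⟨hn1, hn2⟩ := node_mem h0 hδ m
    have hn1 : t m ≤ node M δ m := hn1
    have hn2 : node M δ m ≤ t (m + 1) := hn2
    have hdiff : (1 / (M : ℝ)) * g (node M δ m) - (1 / 2) * ∫ x in (t m)..(t (m + 1)), g x =
        (1 / 2) * ∫ x in (t m)..(t (m + 1)), (g (node M δ m) - g x) := by
      rw [intervalIntegral.integral_sub (by simp) (hint m hm'), intervalIntegral.integral_const,
        hstep, smul_eq_mul]
      ring
    have hb : ‖∫ x in (t m)..(t (m + 1)), (g (node M δ m) - g x)‖ ≤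
        (w (t (m + 1)) - w (t m)) * |t (m + 1) - t m| := by
      refine intervalIntegral.norm_integral_le_of_norm_le_const fun x hx => ?_
      rw [Set.uIoc_of_le (htmono m.le_succ)] at hx
      have hx1 := hx.1.le
      have hx2 := hx.2
      have := hlo m
      have := hhi _ hm'
      rw [Real.norm_eq_abs]
      rcases le_total x (node M δ m) with h | h
      · have := hw x (node M δ m) (by linarith) h (by linarith)
        have := hwmono (t m) x (by linarith) hx1 (by linarith)
        have := hwmono (node M δ m) (t (m + 1)) (by linarith) hn2 (by linarith)
        linarith
      · rw [abs_sub_comm]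
        have := hw (node M δ m) x (by linarith) h (by linarith)
        have := hwmono x (t (m + 1)) (by linarith) hx2 (by linarith)
        have := hwmono (t m) (node M δ m) (by linarith) hn1 (by linarith)
        linarith
    rw [hdiff, abs_mul, abs_of_pos (by norm_num : (0 : ℝ) < 1 / 2)]
    rw [Real.norm_eq_abs, hstep, abs_of_pos (by positivity : (0 : ℝ) < 2 / M)] at hb
    calc _ ≤ 1 / 2 * ((w (t (m + 1)) - w (t m)) * (2 / M)) := by gcongr
      _ = _ := by ring
  rw [hsum, Finset.mul_sum, Finset.mul_sum, ← Finset.sum_sub_distrib]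
  calc _ ≤ _ := Finset.abs_sum_le_sum_abs _ _
    _ ≤ ∑ m ∈ Finset.range M, (w (t (m + 1)) - w (t m)) / M := Finset.sum_le_sum hcell
    _ = _ := by rw [← Finset.sum_div, Finset.sum_range_sub (fun m => w (t m)), ht0, htM]

/-- If the increments of `f` on `[-1, 1]` are dominated by those of `w` and `|f| ≤ 1`, then those of
`f ^ k * x ^ l` are dominated by those of `k * w + l * x`. -/
lemma abs_pow_mul_pow_sub_le {f w : ℝ → ℝ} (hf : ∀ x ∈ Set.Icc (-1 : ℝ) 1, |f x| ≤ 1)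
    (hw : ∀ x y, -1 ≤ x → x ≤ y → y ≤ 1 → |f y - f x| ≤ w y - w x) (k l : ℕ) (x y : ℝ)
    (hx : -1 ≤ x) (hxy : x ≤ y) (hy : y ≤ 1) :
    |f y ^ k * y ^ l - f x ^ k * x ^ l| ≤ (k * w y + l * y) - (k * w x + l * x) := by
  have hpow : ∀ (n : ℕ) (u v : ℝ), |u| ≤ 1 → |v| ≤ 1 → |u ^ n - v ^ n| ≤ n * |u - v| := by
    intro n u v hu hv
    induction n with
    | zero => simp
    | succ n ih =>
      have : u ^ (n + 1) - v ^ (n + 1) = u * (u ^ n - v ^ n) + (u - v) * v ^ n := by ring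
      rw [this]
      have h1 : |v| ^ n ≤ 1 := pow_le_one₀ (abs_nonneg _) hv
      calc _ ≤ |u| * |u ^ n - v ^ n| + |u - v| * |v| ^ n := by
            rw [← abs_mul, ← abs_pow, ← abs_mul]; exact abs_add_le _ _
        _ ≤ 1 * (n * |u - v|) + |u - v| * 1 := by gcongr
        _ = _ := by push_cast; ring
  have hx' : |x| ≤ 1 := abs_le.mpr ⟨hx, by linarith⟩
  have hy' : |y| ≤ 1 := abs_le.mpr ⟨by linarith, hy⟩
  have hfx := hf x ⟨hx, by linarith⟩
  have hfy := hf y ⟨by linarith, hy⟩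
  have h1 := hpow k (f y) (f x) hfy hfx
  have h2 := hpow l y x hy' hx'
  rw [abs_of_nonneg (sub_nonneg.mpr hxy)] at h2
  have h3 : |y| ^ l ≤ 1 := pow_le_one₀ (abs_nonneg _) hy'
  have h4 : |f x| ^ k ≤ 1 := pow_le_one₀ (abs_nonneg _) hfx
  have h5 : f y ^ k * y ^ l - f x ^ k * x ^ l =
      (f y ^ k - f x ^ k) * y ^ l + f x ^ k * (y ^ l - x ^ l) := by ring
  rw [h5]
  calc _ ≤ |f y ^ k - f x ^ k| * |y| ^ l + |f x| ^ k * |y ^ l - x ^ l| := by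
        rw [← abs_pow, ← abs_mul, ← abs_pow, ← abs_mul]; exact abs_add_le _ _
    _ ≤ (k * |f y - f x|) * 1 + 1 * (l * (y - x)) := by gcongr
    _ ≤ (k * (w y - w x)) * 1 + 1 * (l * (y - x)) := by gcongr; exact hw x y hx hxy hy
    _ = _ := by ring

end EDMD
end

/-! ### The Hankel matrix of the moments and its perturbations -/

noncomputable section

namespace EDMD

open MeasureTheory Polynomial

/-- The polynomial `∑ u_k z ^ k`. -/
def polyEval {N : ℕ} (u : Fin N → ℂ) (z : ℂ) : ℂ := ∑ k, u k * z ^ (k : ℕ)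

lemma continuous_polyEval {N : ℕ} (u : Fin N → ℂ) : Continuous (polyEval u) := by
  unfold polyEval
  fun_prop

/-- The squared norm of a polynomial in `L²(-1, 1)` with normalized Lebesgue measure. -/
def polyNormSq {N : ℕ} (u : Fin N → ℂ) : ℝ :=
  (1 / 2) * ∫ x in (-1 : ℝ)..1, ‖polyEval u (x : ℂ)‖ ^ 2

lemma sum_norm_sq_le_polyNormSq {N : ℕ} (u : Fin N → ℂ) :
    ∑ k, ‖u k‖ ^ 2 ≤ gam ^ N * polyNormSq u := by
  set p : ℂ[X] := ∑ k : Fin N, C (u k) * X ^ (k : ℕ) with hp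
  have hcoeff : ∀ i : Fin N, p.coeff i = u i := fun i => by
    simp [hp, finsetSum_coeff, coeff_C_mul, coeff_X_pow, Fin.val_inj]
  have hdeg : p.degree < N := by
    refine (degree_sum_le _ _).trans_lt
      ((Finset.sup_lt_iff (WithBot.bot_lt_coe N)).mpr fun k _ => ?_)
    exact (degree_C_mul_X_pow_le _ _).trans_lt (Nat.cast_lt.mpr k.2)
  have heval : ∀ z, p.eval z = polyEval u z := fun z => by
    simp [hp, polyEval, eval_finsetSum]
  have h := sum_norm_coeff_sq_le N p hdeg
  rw [← Fin.sum_univ_eq_sum_range (fun i => ‖p.coeff i‖ ^ 2)] at h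
  simpa only [hcoeff, heval, polyNormSq] using h

/-- The moments of the normalized Lebesgue measure on `[-1, 1]`, the limits of the entries of the
matrices `matH`. -/
def moment (n : ℕ) : ℂ := (1 / 2) * ∫ x in (-1 : ℝ)..1, (x : ℂ) ^ n

lemma sum_conj_mul_moment {N : ℕ} (u : Fin N → ℂ) :
    ∑ j, (starRingEnd ℂ) (u j) * ∑ k : Fin N, moment (j + k) * u k = polyNormSq u := by
  have h1 : ∀ x : ℝ, ((‖polyEval u (x : ℂ)‖ ^ 2 : ℝ) : ℂ) =
      ∑ j, ∑ k, (starRingEnd ℂ) (u j) * u k * (x : ℂ) ^ ((j : ℕ) + k) := by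
    intro x
    push_cast
    rw [← Complex.conj_mul', polyEval, map_sum, Finset.sum_mul_sum]
    refine Finset.sum_congr rfl fun j _ => Finset.sum_congr rfl fun k _ => ?_
    rw [map_mul, map_pow, Complex.conj_ofReal]
    ring
  rw [polyNormSq, Complex.ofReal_mul, ← intervalIntegral.integral_ofReal]
  simp_rw [h1]
  rw [intervalIntegral.integral_finsetSum fun j _ =>
    (by fun_prop : Continuous _).intervalIntegrable _ _, Finset.mul_sum]
  refine Finset.sum_congr rfl fun j _ => ?_
  rw [intervalIntegral.integral_finsetSum fun j _ =>
    (by fun_prop : Continuous _).intervalIntegrable _ _, Finset.mul_sum, Finset.mul_sum]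
  refine Finset.sum_congr rfl fun k _ => ?_
  rw [intervalIntegral.integral_const_mul, moment]
  push_cast
  ring

/-- The quadratic form of a matrix with entries bounded by `ε` is bounded by `ε N`. -/
lemma norm_sum_conj_mul_mulVec_le {N : ℕ} (u : Fin N → ℂ) {D : Matrix (Fin N) (Fin N) ℂ} {ε : ℝ}
    (hD : ∀ j k, ‖D j k‖ ≤ ε) :
    ‖∑ j, (starRingEnd ℂ) (u j) * D.mulVec u j‖ ≤ ε * N * ∑ k, ‖u k‖ ^ 2 := by
  rcases N.eq_zero_or_pos with rfl | hN
  · simp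
  have hε : 0 ≤ ε := (norm_nonneg _).trans (hD ⟨0, hN⟩ ⟨0, hN⟩)
  calc _ ≤ ∑ j, ‖u j‖ * ∑ k, ε * ‖u k‖ := by
        refine (norm_sum_le _ _).trans (Finset.sum_le_sum fun j _ => ?_)
        rw [norm_mul, RCLike.norm_conj]
        refine mul_le_mul_of_nonneg_left ?_ (norm_nonneg _)
        rw [Matrix.mulVec, dotProduct]
        refine (norm_sum_le _ _).trans (Finset.sum_le_sum fun k _ => ?_)
        rw [norm_mul]
        exact mul_le_mul_of_nonneg_right (hD j k) (norm_nonneg _)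
    _ = ε * (∑ k, ‖u k‖) ^ 2 := by rw [← Finset.sum_mul, ← Finset.mul_sum]; ring
    _ ≤ ε * (N * ∑ k, ‖u k‖ ^ 2) := by
        gcongr
        simpa using sq_sum_le_card_mul_sum_sq (s := Finset.univ) (f := fun k => ‖u k‖)
    _ = _ := by ring

section perturbation

variable {N : ℕ} {H : Matrix (Fin N) (Fin N) ℂ} {ε : ℝ}

/-- A matrix close to the Hankel matrix of the moments is coercive with respect to the norm of
`L²(-1, 1)`. -/
lemma polyNormSq_le (hH : ∀ j k : Fin N, ‖H j k - moment (j + k)‖ ≤ ε)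
    (hε : 2 * ε * N * gam ^ N ≤ 1) (u : Fin N → ℂ) :
    polyNormSq u ≤ 2 * ‖∑ j, (starRingEnd ℂ) (u j) * H.mulVec u j‖ := by
  rcases N.eq_zero_or_pos with rfl | hN
  · simp [polyNormSq, polyEval]
  have hε0 : 0 ≤ ε := (norm_nonneg _).trans (hH ⟨0, hN⟩ ⟨0, hN⟩)
  have h0 : 0 ≤ polyNormSq u := mul_nonneg (by norm_num)
    (intervalIntegral.integral_nonneg (by norm_num) fun _ _ => by positivity)
  have h1 := norm_sum_conj_mul_mulVec_le u (D := fun j k : Fin N => H j k - moment (j + k)) hH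
  have h2 : (polyNormSq u : ℂ) = (∑ j, (starRingEnd ℂ) (u j) * H.mulVec u j) -
      ∑ j, (starRingEnd ℂ) (u j) *
        Matrix.mulVec (fun j k : Fin N => H j k - moment (j + k)) u j := by
    rw [← sum_conj_mul_moment, ← Finset.sum_sub_distrib]
    refine Finset.sum_congr rfl fun j _ => ?_
    rw [← mul_sub]
    congr 1
    simp only [Matrix.mulVec, dotProduct, sub_mul, Finset.sum_sub_distrib]
    ring
  have h3 : polyNormSq u = ‖(polyNormSq u : ℂ)‖ := by
    rw [Complex.norm_real, Real.norm_of_nonneg h0]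
  have h4 : ε * N * ∑ k, ‖u k‖ ^ 2 ≤ 1 / 2 * polyNormSq u :=
    calc _ ≤ ε * N * (gam ^ N * polyNormSq u) := by
          gcongr
          exact sum_norm_sq_le_polyNormSq u
      _ = (2 * ε * N * gam ^ N) * (1 / 2 * polyNormSq u) := by ring
      _ ≤ 1 * (1 / 2 * polyNormSq u) := by gcongr
      _ = _ := one_mul _
  have h5 := norm_sub_le (∑ j, (starRingEnd ℂ) (u j) * H.mulVec u j) (∑ j, (starRingEnd ℂ) (u j) *
        Matrix.mulVec (fun j k : Fin N => H j k - moment (j + k)) u j)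
  rw [← h2, ← h3] at h5
  linarith

lemma isUnit_det_of_close (hH : ∀ j k : Fin N, ‖H j k - moment (j + k)‖ ≤ ε)
    (hε : 2 * ε * N * gam ^ N ≤ 1) : IsUnit H.det := by
  rw [isUnit_iff_ne_zero, Ne, ← Matrix.exists_mulVec_eq_zero_iff]
  rintro ⟨u, hu, h0⟩
  have h1 := polyNormSq_le hH hε u
  have h2 := sum_norm_sq_le_polyNormSq u
  simp only [h0, Pi.zero_apply, mul_zero, Finset.sum_const_zero, norm_zero] at h1
  have hg : 0 < gam ^ N := pow_pos (by linarith [gam_gt_five]) _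
  have h3 : ∑ k, ‖u k‖ ^ 2 ≤ 0 := h2.trans (mul_nonpos_of_nonneg_of_nonpos hg.le h1)
  refine hu (funext fun k => ?_)
  have := (Finset.sum_eq_zero_iff_of_nonneg fun k _ => by positivity).mp
    (le_antisymm h3 (by positivity)) k (Finset.mem_univ k)
  simpa using this

/-- A general right hand side is amplified by the factor `2 gam ^ N`. -/
lemma sum_norm_sq_le_of_mulVec_eq (hH : ∀ j k : Fin N, ‖H j k - moment (j + k)‖ ≤ ε)
    (hε : 2 * ε * N * gam ^ N ≤ 1) {u t : Fin N → ℂ} (hu : H.mulVec u = t) :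
    ∑ k, ‖u k‖ ^ 2 ≤ 4 * (gam ^ N) ^ 2 * ∑ k, ‖t k‖ ^ 2 := by
  have hg : 0 < gam ^ N := pow_pos (by linarith [gam_gt_five]) _
  have h1 := polyNormSq_le hH hε u
  have h2 := sum_norm_sq_le_polyNormSq u
  rw [hu] at h1
  have h3 : gam ^ N * (2 * ‖∑ j, (starRingEnd ℂ) (u j) * t j‖) ≤
      ∑ k, (1 / 2 * ‖u k‖ ^ 2 + 2 * (gam ^ N) ^ 2 * ‖t k‖ ^ 2) := by
    rw [← mul_assoc]
    calc _ ≤ gam ^ N * 2 * ∑ j, ‖u j‖ * ‖t j‖ := by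
          gcongr
          refine (norm_sum_le _ _).trans_eq (Finset.sum_congr rfl fun j _ => ?_)
          rw [norm_mul, RCLike.norm_conj]
      _ ≤ _ := by
          rw [Finset.mul_sum]
          refine Finset.sum_le_sum fun j _ => ?_
          nlinarith [sq_nonneg (‖u j‖ - 2 * gam ^ N * ‖t j‖)]
  rw [Finset.sum_add_distrib, ← Finset.mul_sum, ← Finset.mul_sum] at h3
  have h4 : gam ^ N * polyNormSq u ≤ gam ^ N * (2 * ‖∑ j, (starRingEnd ℂ) (u j) * t j‖) := by
    gcongr
  linarith

/-- A right hand side formed by the moments of a function `f` is amplified only by the factor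
`2 gam ^ (N / 2)` relative to `f`: the solution is nearly the orthogonal projection of `f` onto the
polynomials, so only the passage from the norm of `L²(-1, 1)` to coefficients costs. -/
lemma sum_norm_sq_le_of_mulVec_eq_integral (hH : ∀ j k : Fin N, ‖H j k - moment (j + k)‖ ≤ ε)
    (hε : 2 * ε * N * gam ^ N ≤ 1) {u : Fin N → ℂ} {f : ℝ → ℂ} {S : ℝ}
    (hf : ContinuousOn f (Set.Icc (-1) 1)) (hS : ∀ x ∈ Set.Icc (-1 : ℝ) 1, ‖f x‖ ≤ S)
    (hu : ∀ j : Fin N, H.mulVec u j = (1 / 2) * ∫ x in (-1 : ℝ)..1, (x : ℂ) ^ (j : ℕ) * f x) :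
    ∑ k, ‖u k‖ ^ 2 ≤ 4 * gam ^ N * S ^ 2 := by
  have hg : 0 < gam ^ N := pow_pos (by linarith [gam_gt_five]) _
  have h1 := polyNormSq_le hH hε u
  have h2 := sum_norm_sq_le_polyNormSq u
  have hle : (-1 : ℝ) ≤ 1 := by norm_num
  have hconj : ∑ j, (starRingEnd ℂ) (u j) * H.mulVec u j =
      (1 / 2) * ∫ x in (-1 : ℝ)..1, (starRingEnd ℂ) (polyEval u x) * f x := by
    have h3 : ∀ x : ℝ, (starRingEnd ℂ) (polyEval u x) * f x =
        ∑ j, (starRingEnd ℂ) (u j) * ((x : ℂ) ^ (j : ℕ) * f x) := by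
      intro x
      rw [polyEval, map_sum, Finset.sum_mul]
      refine Finset.sum_congr rfl fun j _ => ?_
      rw [map_mul, map_pow, Complex.conj_ofReal, mul_assoc]
    simp_rw [h3]
    have h4 : ∀ j : Fin N, IntervalIntegrable
        (fun x : ℝ => (starRingEnd ℂ) (u j) * ((x : ℂ) ^ (j : ℕ) * f x)) volume (-1) 1 := fun j =>
      ContinuousOn.intervalIntegrable <| by
        rw [Set.uIcc_of_le hle]
        exact continuousOn_const.mul (ContinuousOn.mul (by fun_prop) hf)
    rw [intervalIntegral.integral_finsetSum fun j _ => h4 j, Finset.mul_sum]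
    refine Finset.sum_congr rfl fun j _ => ?_
    rw [hu, intervalIntegral.integral_const_mul]
    ring
  have hpc : Continuous fun x : ℝ => polyEval u x :=
    (continuous_polyEval u).comp Complex.continuous_ofReal
  have hbound : ‖∑ j, (starRingEnd ℂ) (u j) * H.mulVec u j‖ ≤ polyNormSq u / 4 + S ^ 2 := by
    rw [hconj, norm_mul]
    have h4 : ‖∫ x in (-1 : ℝ)..1, (starRingEnd ℂ) (polyEval u x) * f x‖ ≤
        ∫ x in (-1 : ℝ)..1, (1 / 4 * ‖polyEval u (x : ℂ)‖ ^ 2 + S ^ 2) := by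
      refine intervalIntegral.norm_integral_le_of_norm_le hle (ae_of_all _ fun x hx => ?_)
        ((by fun_prop : Continuous _).intervalIntegrable _ _)
      have := hS x (Set.Ioc_subset_Icc_self hx)
      rw [norm_mul, RCLike.norm_conj]
      nlinarith [sq_nonneg (‖polyEval u (x : ℂ)‖ / 2 - S), norm_nonneg (polyEval u (x : ℂ))]
    rw [intervalIntegral.integral_add ((by fun_prop : Continuous _).intervalIntegrable _ _)
      (by simp), intervalIntegral.integral_const_mul, intervalIntegral.integral_const] at h4
    rw [polyNormSq]
    norm_num at h4 ⊢
    linarith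
  have h5 : polyNormSq u ≤ 4 * S ^ 2 := by linarith
  calc _ ≤ gam ^ N * polyNormSq u := h2
    _ ≤ gam ^ N * (4 * S ^ 2) := by gcongr
    _ = _ := by ring

end perturbation

/-- The entries of `matH` are close to the moments. -/
lemma norm_matH_sub_moment_le {N M : ℕ} {δ : ℝ} (hM : 0 < M) (h0 : 0 ≤ δ) (hδ : δ ≤ 2 / (M : ℝ))
    (j k : Fin N) : ‖matH N M δ j k - moment (j + k)‖ ≤ 4 * N / M := by
  have h := abs_riemannSum_sub_integral_le (g := fun x : ℝ => x ^ (j : ℕ) * x ^ (k : ℕ)) hM h0 hδ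
    ((by fun_prop : Continuous _).intervalIntegrable _ _)
    (abs_pow_mul_pow_sub_le (f := fun x => x) (w := fun x => x)
      (fun x hx => abs_le.mpr hx) (fun x y _ hxy _ => (abs_of_nonneg (sub_nonneg.mpr hxy)).le) j k)
  have hm : moment (j + k) =
      (((1 / 2) * ∫ x in (-1 : ℝ)..1, x ^ (j : ℕ) * x ^ (k : ℕ) : ℝ) : ℂ) := by
    rw [moment, Complex.ofReal_mul, ← intervalIntegral.integral_ofReal]
    push_cast
    simp only [pow_add]
  rw [hm, matH, ← Complex.ofReal_sub, Complex.norm_real, Real.norm_eq_abs]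
  refine h.trans ?_
  have hj : ((j : ℕ) : ℝ) ≤ N := by exact_mod_cast j.2.le
  have hk : ((k : ℕ) : ℝ) ≤ N := by exact_mod_cast k.2.le
  gcongr
  linarith

end EDMD
end

/-! ### Full branch maps are of bounded variation -/

noncomputable section

namespace EDMD

open MeasureTheory Set

/-- `f` is of bounded variation on bounded intervals, expressed by a function `w` whose increments
dominate those of `f`. This form is stable under finite sums and suits estimates of Riemann sums. -/
def HasDominatedIncrements (f : ℝ → ℝ) : Prop :=
  ∃ w : ℝ → ℝ, ∀ x y, x ≤ y → |f y - f x| ≤ w y - w x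

namespace HasDominatedIncrements

lemma neg {f : ℝ → ℝ} (hf : HasDominatedIncrements f) : HasDominatedIncrements (fun x => -f x) := by
  obtain ⟨w, hw⟩ := hf
  refine ⟨w, fun x y hxy => ?_⟩
  have : -f y - -f x = -(f y - f x) := by ring
  rw [this, abs_neg]
  exact hw x y hxy

lemma add {f g : ℝ → ℝ} (hf : HasDominatedIncrements f) (hg : HasDominatedIncrements g) :
    HasDominatedIncrements (fun x => f x + g x) := by
  obtain ⟨v, hv⟩ := hf
  obtain ⟨w, hw⟩ := hg
  refine ⟨fun x => v x + w x, fun x y hxy => ?_⟩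
  have : f y + g y - (f x + g x) = (f y - f x) + (g y - g x) := by ring
  rw [this]
  refine (abs_add_le _ _).trans ?_
  linarith [hv x y hxy, hw x y hxy]

lemma sum {ι : Type*} (s : Finset ι) {f : ι → ℝ → ℝ} (hf : ∀ i ∈ s, HasDominatedIncrements (f i)) :
    HasDominatedIncrements (fun x => ∑ i ∈ s, f i x) := by
  classical
  induction s using Finset.induction_on with
  | empty => exact ⟨0, by simp⟩
  | insert i s his ih =>
    simp only [Finset.sum_insert his]
    exact (hf i (Finset.mem_insert_self _ _)).add
      (ih fun j hj => hf j (Finset.mem_insert_of_mem hj))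

lemma spike (s c : ℝ) : HasDominatedIncrements (fun x => if x = s then c else 0) := by
  refine ⟨fun x => if x < s then 0 else if x = s then |c| else 2 * |c|, fun x y hxy => ?_⟩
  have := abs_nonneg c
  dsimp only
  rw [abs_le]
  constructor <;> split_ifs <;> grind [le_abs_self c, neg_abs_le c]

lemma indicator_of_monotoneOn {h : ℝ → ℝ} {a b : ℝ} (hm : MonotoneOn h (Ioo a b))
    (h1 : ∀ x ∈ Ioo a b, |h x| ≤ 1) : HasDominatedIncrements ((Ioo a b).indicator h) := by
  classical
  -- the jumps of the indicator at `a` and `b` are at most `1`, so the monotone extension of `h` by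
  -- `-1` on the left and `1` on the right is raised by `1` at `a` and by another `1` at `b`
  refine ⟨fun x => if x ≤ a then -1 else if x < b then h x + 1 else 3, fun x y hxy => ?_⟩
  by_cases hx : x ∈ Ioo a b <;> by_cases hy : y ∈ Ioo a b
  · have := hm hx hy hxy
    simp only [hx, hy, indicator_of_mem, not_le.mpr hx.1, not_le.mpr hy.1, hx.2, hy.2, if_true,
      if_false]
    rw [abs_of_nonneg] <;> linarith
  · have hyb : b ≤ y := by
      by_contra hcon
      exact hy ⟨hx.1.trans_le hxy, not_le.mp hcon⟩
    have := abs_le.mp (h1 x hx)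
    simp only [hx, hy, indicator_of_mem, indicator_of_notMem, not_false_eq_true, not_le.mpr hx.1,
      not_le.mpr (hx.1.trans_le hxy), not_lt.mpr hyb, hx.2, if_true, if_false]
    rw [abs_le]; constructor <;> linarith
  · have hxa : x ≤ a := by
      by_contra hcon
      exact hx ⟨not_le.mp hcon, hxy.trans_lt hy.2⟩
    have := abs_le.mp (h1 y hy)
    simp only [hx, hy, indicator_of_mem, indicator_of_notMem, not_false_eq_true, hxa,
      not_le.mpr hy.1, hy.2, if_true, if_false]
    rw [abs_le]; constructor <;> linarith
  · simp only [hx, hy, indicator_of_notMem, not_false_eq_true, sub_self, abs_zero]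
    by_cases hxa : x ≤ a
    · by_cases hya : y ≤ a
      · simp [hxa, hya]
      · have : ¬ y < b := fun h => hy ⟨not_le.mp hya, h⟩
        simp [hxa, hya, this]; norm_num
    · have hya : ¬ y ≤ a := fun h => hxa (hxy.trans h)
      have h2 : ¬ x < b := fun h => hx ⟨not_le.mp hxa, h⟩
      have h3 : ¬ y < b := fun h => hy ⟨not_le.mp hya, h⟩
      simp [hxa, hya, h2, h3]

end HasDominatedIncrements

namespace IsFullBranchMap

variable {d : ℕ} {T : ℝ → ℝ} {a b : Fin d → ℝ}

lemma Icc_subset (hT : IsFullBranchMap T a b) (ℓ : Fin d) : Icc (a ℓ) (b ℓ) ⊆ Icc (-1) 1 := by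
  rw [hT.cover]
  exact subset_iUnion (fun ℓ => Icc (a ℓ) (b ℓ)) ℓ

lemma mem_Icc (hT : IsFullBranchMap T a b) {ℓ : Fin d} {x : ℝ} (hx : x ∈ Ioo (a ℓ) (b ℓ)) :
    x ∈ Icc (-1 : ℝ) 1 := hT.Icc_subset ℓ (Ioo_subset_Icc_self hx)

lemma abs_le_one (hT : IsFullBranchMap T a b) {x : ℝ} (hx : x ∈ Icc (-1 : ℝ) 1) : |T x| ≤ 1 :=
  abs_le.mpr (hT.mapsTo hx)

lemma continuousOn (hT : IsFullBranchMap T a b) (ℓ : Fin d) : ContinuousOn T (Ioo (a ℓ) (b ℓ)) :=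
  (hT.analytic ℓ).continuousOn

lemma strictMonoOn_or (hT : IsFullBranchMap T a b) (ℓ : Fin d) :
    StrictMonoOn T (Ioo (a ℓ) (b ℓ)) ∨ StrictAntiOn T (Ioo (a ℓ) (b ℓ)) :=
  (hT.continuousOn ℓ).strictMonoOn_of_injOn_Ioo (hT.lt ℓ) (hT.injOn ℓ)

/-- The end points of the branch domains. -/
def endpoints (a b : Fin d → ℝ) : Finset ℝ := Finset.univ.image a ∪ Finset.univ.image b

lemma exists_mem_Ioo (hT : IsFullBranchMap T a b) {x : ℝ} (hx : x ∈ Icc (-1 : ℝ) 1)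
    (hxS : x ∉ endpoints a b) : ∃ ℓ, x ∈ Ioo (a ℓ) (b ℓ) := by
  rw [hT.cover] at hx
  obtain ⟨ℓ, hℓ⟩ := mem_iUnion.mp hx
  simp only [endpoints, Finset.mem_union, Finset.mem_image, Finset.mem_univ, true_and, not_or,
    not_exists] at hxS
  exact ⟨ℓ, lt_of_le_of_ne hℓ.1 (hxS.1 ℓ), lt_of_le_of_ne hℓ.2 fun h => hxS.2 ℓ h.symm⟩

/-- A full branch map is of bounded variation: it is the sum of its restrictions to the open branch
domains, where it is monotone, and of spikes at the end points. -/
lemma exists_dominating (hT : IsFullBranchMap T a b) :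
    ∃ w : ℝ → ℝ, ∀ x y, -1 ≤ x → x ≤ y → y ≤ 1 → |T y - T x| ≤ w y - w x := by
  classical
  set F : ℝ → ℝ := fun x => ∑ ℓ, (Ioo (a ℓ) (b ℓ)).indicator T x with hF
  have hFd : HasDominatedIncrements F := by
    refine .sum _ fun ℓ _ => ?_
    rcases hT.strictMonoOn_or ℓ with h | h
    · exact .indicator_of_monotoneOn h.monotoneOn fun x hx => hT.abs_le_one (hT.mem_Icc hx)
    · have := (HasDominatedIncrements.indicator_of_monotoneOn h.antitoneOn.neg fun x hx => by
        simpa using hT.abs_le_one (hT.mem_Icc hx)).neg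
      convert this using 2 with x
      by_cases hx : x ∈ Ioo (a ℓ) (b ℓ) <;> simp [hx]
  set E : ℝ → ℝ := fun x => ∑ s ∈ endpoints a b, if x = s then T s - F s else 0 with hE
  have hEd : HasDominatedIncrements E := .sum _ fun s _ => .spike s _
  have hTF : ∀ x ∈ Icc (-1 : ℝ) 1, T x = F x + E x := by
    intro x hx
    by_cases hxS : x ∈ endpoints a b
    · simp only [hE]
      rw [Finset.sum_ite_eq, if_pos hxS]; ring
    · obtain ⟨ℓ, hℓ⟩ := hT.exists_mem_Ioo hx hxS
      have h1 : E x = 0 := Finset.sum_eq_zero fun s hs => if_neg (ne_of_mem_of_not_mem hs hxS).symm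
      have h2 : F x = T x := by
        simp only [hF]
        rw [Finset.sum_eq_single ℓ, indicator_of_mem hℓ]
        · intro i _ hi
          exact indicator_of_notMem (fun h => (hT.disjoint i ℓ hi).le_bot ⟨h, hℓ⟩) _
        · simp
      rw [h1, h2, add_zero]
  obtain ⟨w, hw⟩ := hFd.add hEd
  refine ⟨w, fun x y hx hxy hy => ?_⟩
  rw [hTF x ⟨hx, by linarith⟩, hTF y ⟨by linarith, hy⟩]
  exact hw x y hxy

/-- Each open branch is mapped onto the open interval. The two end points of the branch domain add
at most two points to the image, which cannot fill a gap. -/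
lemma image_Ioo (hT : IsFullBranchMap T a b) (ℓ : Fin d) :
    T '' Ioo (a ℓ) (b ℓ) = Ioo (-1) 1 := by
  set S := T '' Ioo (a ℓ) (b ℓ) with hS
  have hSsub : S ⊆ Icc (-1) 1 := by
    rintro _ ⟨x, hx, rfl⟩
    exact hT.mapsTo (hT.mem_Icc hx)
  have hconn : OrdConnected S := (isPreconnected_Ioo.image T (hT.continuousOn ℓ)).ordConnected
  -- every value on the open branch lies strictly between two others
  have hbetween : ∀ y ∈ S, (∃ z ∈ S, z < y) ∧ ∃ z ∈ S, y < z := by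
    rintro _ ⟨x, hx, rfl⟩
    obtain ⟨u, hau, hux⟩ := exists_between hx.1
    obtain ⟨v, hxv, hvb⟩ := exists_between hx.2
    have hu : u ∈ Ioo (a ℓ) (b ℓ) := ⟨hau, hux.trans hx.2⟩
    have hv : v ∈ Ioo (a ℓ) (b ℓ) := ⟨hx.1.trans hxv, hvb⟩
    rcases hT.strictMonoOn_or ℓ with h | h
    · exact ⟨⟨T u, ⟨u, hu, rfl⟩, h hu hx hux⟩, ⟨T v, ⟨v, hv, rfl⟩, h hx hv hxv⟩⟩
    · exact ⟨⟨T v, ⟨v, hv, rfl⟩, h hx hv hxv⟩, ⟨T u, ⟨u, hu, rfl⟩, h hu hx hux⟩⟩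
  have hcl : ∀ u v : ℝ, u < v → Ioo u v ⊆ Icc (-1) 1 → ∃ z ∈ S, z ∈ Ioo u v := by
    intro u v huv hsub
    obtain ⟨z, hz, hzT⟩ : ∃ z ∈ Ioo u v, z ∉ ({T (a ℓ), T (b ℓ)} : Set ℝ) :=
      ((Ioo_infinite huv).sdiff (toFinite ({T (a ℓ), T (b ℓ)} : Set ℝ))).nonempty
    have hz1 : z ∈ closure (T '' Icc (a ℓ) (b ℓ)) := by
      rw [hT.full ℓ]; exact hsub hz
    have hz2 : T '' Icc (a ℓ) (b ℓ) ⊆ S ∪ {T (a ℓ), T (b ℓ)} := by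
      rintro _ ⟨x, hx, rfl⟩
      rcases hx.1.eq_or_lt with h | h
      · right; left; rw [h]
      rcases hx.2.eq_or_lt with h' | h'
      · right; right; rw [h']; rfl
      · left; exact ⟨x, ⟨h, h'⟩, rfl⟩
    have hz3 := closure_mono hz2 hz1
    rw [closure_union, (toFinite ({T (a ℓ), T (b ℓ)} : Set ℝ)).isClosed.closure_eq] at hz3
    have hz4 : z ∈ closure S := hz3.resolve_right hzT
    obtain ⟨y, hy1, hy2⟩ := mem_closure_iff.mp hz4 (Ioo u v) isOpen_Ioo hz
    exact ⟨y, hy2, hy1⟩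
  refine Subset.antisymm (fun y hy => ?_) fun y hy => ?_
  · obtain ⟨⟨z, hz, hzy⟩, z', hz', hyz'⟩ := hbetween y hy
    exact ⟨(hSsub hz).1.trans_lt hzy, hyz'.trans_le (hSsub hz').2⟩
  · obtain ⟨z, hzS, hz⟩ := hcl (-1) y hy.1 fun x hx => ⟨hx.1.le, (hx.2.trans hy.2).le⟩
    obtain ⟨z', hzS', hz'⟩ := hcl y 1 hy.2 fun x hx => ⟨(hy.1.trans hx.1).le, hx.2.le⟩
    exact hconn.out hzS hzS' ⟨hz.2.le, hz'.1.le⟩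

lemma iUnion_Ioo_ae_eq (hT : IsFullBranchMap T a b) :
    (⋃ ℓ, Ioo (a ℓ) (b ℓ) : Set ℝ) =ᵐ[volume] Ioc (-1 : ℝ) 1 := by
  refine Filter.EventuallyEq.trans ?_ Ioc_ae_eq_Icc.symm
  refine Filter.EventuallyLE.antisymm ?_ ?_
  · exact (iUnion_subset fun ℓ x hx => hT.mem_Icc hx).eventuallyLE
  · rw [ae_le_set]
    refine measure_mono_null (t := (endpoints a b : Set ℝ)) ?_ (Finset.measure_zero _ _)
    rintro x ⟨hx, hx'⟩
    by_contra hcon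
    exact hx' (mem_iUnion.mpr (hT.exists_mem_Ioo hx hcon))

/-- A bounded function that is continuous on the open branches is integrable. -/
lemma intervalIntegrable (hT : IsFullBranchMap T a b) {E : Type*} [NormedAddCommGroup E]
    {F : ℝ → E} (hF : ∀ ℓ, ContinuousOn F (Ioo (a ℓ) (b ℓ))) {C : ℝ}
    (hC : ∀ x ∈ Icc (-1 : ℝ) 1, ‖F x‖ ≤ C) :
    (∀ ℓ, IntegrableOn F (Ioo (a ℓ) (b ℓ))) ∧ IntervalIntegrable F volume (-1) 1 := by
  have h1 : ∀ ℓ, IntegrableOn F (Ioo (a ℓ) (b ℓ)) := fun ℓ =>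
    IntegrableOn.of_bound (by simp) ((hF ℓ).aestronglyMeasurable measurableSet_Ioo) C
      ((ae_restrict_iff' measurableSet_Ioo).mpr (ae_of_all _ fun x hx => hC x (hT.mem_Icc hx)))
  refine ⟨h1, ?_⟩
  rw [intervalIntegrable_iff_integrableOn_Ioc_of_le (by norm_num)]
  exact (integrableOn_finite_iUnion.mpr h1).congr_set_ae hT.iUnion_Ioo_ae_eq.symm

end IsFullBranchMap
end EDMD
end

/-! ### Inverse branches and the change of variables -/

noncomputable section

namespace EDMD

open MeasureTheory Set

/-- The real part of `φ_ℓ` on the real line; on `(-1, 1)` it is the inverse branch itself. -/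
def realBranch {d : ℕ} (φ : Fin d → ℂ → ℂ) (ℓ : Fin d) (y : ℝ) : ℝ := (φ ℓ y).re

namespace ExtendsInverseBranches

variable {d : ℕ} {T : ℝ → ℝ} {a b : Fin d → ℝ} {φ : Fin d → ℂ → ℂ} {r R : ℝ}

lemma realBranch_apply (hφ : ExtendsInverseBranches T a b φ r R) {ℓ : Fin d} {x : ℝ}
    (hx : x ∈ Ioo (a ℓ) (b ℓ)) : realBranch φ ℓ (T x) = x := by
  rw [realBranch, hφ.inverse ℓ x hx, Complex.ofReal_re]

lemma realBranch_spec (hT : IsFullBranchMap T a b) (hφ : ExtendsInverseBranches T a b φ r R)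
    (ℓ : Fin d) {y : ℝ} (hy : y ∈ Ioo (-1 : ℝ) 1) :
    realBranch φ ℓ y ∈ Ioo (a ℓ) (b ℓ) ∧ T (realBranch φ ℓ y) = y ∧ φ ℓ y = realBranch φ ℓ y := by
  rw [← hT.image_Ioo ℓ] at hy
  obtain ⟨x, hx, rfl⟩ := hy
  rw [hφ.realBranch_apply hx]
  exact ⟨hx, rfl, hφ.inverse ℓ x hx⟩

lemma image_realBranch (hT : IsFullBranchMap T a b) (hφ : ExtendsInverseBranches T a b φ r R)
    (ℓ : Fin d) : realBranch φ ℓ '' Ioo (-1) 1 = Ioo (a ℓ) (b ℓ) := by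
  refine Subset.antisymm ?_ fun x hx => ?_
  · rintro _ ⟨y, hy, rfl⟩
    exact (hφ.realBranch_spec hT ℓ hy).1
  · exact ⟨T x, hT.image_Ioo ℓ ▸ mem_image_of_mem T hx, hφ.realBranch_apply hx⟩

lemma injOn_realBranch (hT : IsFullBranchMap T a b) (hφ : ExtendsInverseBranches T a b φ r R)
    (ℓ : Fin d) : InjOn (realBranch φ ℓ) (Ioo (-1) 1) :=
  LeftInvOn.injOn (f₁' := T) fun _ hy => (hφ.realBranch_spec hT ℓ hy).2.1

lemma hasDerivAt (hφ : ExtendsInverseBranches T a b φ r R) (hR : 1 < R) (ℓ : Fin d) {y : ℝ}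
    (hy : y ∈ Icc (-1 : ℝ) 1) : HasDerivAt (φ ℓ) (deriv (φ ℓ) y) y := by
  refine ((hφ.holo ℓ).differentiableAt (Metric.isOpen_ball.mem_nhds ?_)).hasDerivAt
  rw [mem_ball_zero_iff, Complex.norm_real]
  exact (abs_le.mpr hy).trans_lt hR

lemma hasDerivAt_realBranch (hφ : ExtendsInverseBranches T a b φ r R) (hR : 1 < R) (ℓ : Fin d)
    {y : ℝ} (hy : y ∈ Icc (-1 : ℝ) 1) :
    HasDerivAt (realBranch φ ℓ) (deriv (φ ℓ) y).re y :=
  (hφ.hasDerivAt hR ℓ hy).real_of_complex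

lemma deriv_eq_ofReal (hT : IsFullBranchMap T a b) (hφ : ExtendsInverseBranches T a b φ r R)
    (hR : 1 < R) (ℓ : Fin d) {y : ℝ} (hy : y ∈ Ioo (-1 : ℝ) 1) :
    deriv (φ ℓ) y = ((deriv (φ ℓ) y).re : ℂ) := by
  have h1 := (hφ.hasDerivAt hR ℓ (Ioo_subset_Icc_self hy)).comp_ofReal
  have h2 := (hφ.hasDerivAt_realBranch hR ℓ (Ioo_subset_Icc_self hy)).ofReal_comp
  refine h1.unique (h2.congr_of_eventuallyEq ?_)
  filter_upwards [isOpen_Ioo.mem_nhds hy] with z hz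
  exact (hφ.realBranch_spec hT ℓ hz).2.2

lemma deriv_re_ne_zero (hT : IsFullBranchMap T a b) (hφ : ExtendsInverseBranches T a b φ r R)
    (hR : 1 < R) (ℓ : Fin d) {y : ℝ} (hy : y ∈ Ioo (-1 : ℝ) 1) : (deriv (φ ℓ) y).re ≠ 0 := by
  have h1 := hφ.hasDerivAt_realBranch hR ℓ (Ioo_subset_Icc_self hy)
  have h2 : HasDerivAt T (deriv T (realBranch φ ℓ y)) (realBranch φ ℓ y) :=
    (hT.analytic ℓ _ (hφ.realBranch_spec hT ℓ hy).1).differentiableAt.hasDerivAt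
  have h3 : HasDerivAt (fun z : ℝ => z) (deriv T (realBranch φ ℓ y) * (deriv (φ ℓ) y).re) y := by
    refine (h2.comp y h1).congr_of_eventuallyEq ?_
    filter_upwards [isOpen_Ioo.mem_nhds hy] with z hz
    exact (hφ.realBranch_spec hT ℓ hz).2.1.symm
  intro h0
  have := h3.unique (hasDerivAt_id' y)
  rw [h0, mul_zero] at this
  exact zero_ne_one this

/-- The sign of `φ_ℓ'` is constant on `(-1, 1)`. -/
lemma sign_mul_deriv (hT : IsFullBranchMap T a b) (hφ : ExtendsInverseBranches T a b φ r R)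
    (hR : 1 < R) (ℓ : Fin d) {y : ℝ} (hy : y ∈ Ioo (-1 : ℝ) 1) :
    ((Real.sign (deriv (φ ℓ) 0).re : ℝ) : ℂ) * deriv (φ ℓ) y = (|(deriv (φ ℓ) y).re| : ℝ) := by
  have hcont : ContinuousOn (realBranch φ ℓ) (Ioo (-1) 1) := fun z hz =>
    (hφ.hasDerivAt_realBranch hR ℓ (Ioo_subset_Icc_self hz)).continuousAt.continuousWithinAt
  have h0 : (0 : ℝ) ∈ Ioo (-1 : ℝ) 1 := by norm_num
  have hacc : ∀ z ∈ Ioo (-1 : ℝ) 1, AccPt z (Filter.principal (Ioo (-1 : ℝ) 1)) := fun z hz =>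
    (Preperfect.open_inter PerfectSpace.univ_preperfect isOpen_Ioo) z (by simpa using hz) |>.mono
      (by simp)
  have hne0 := hφ.deriv_re_ne_zero hT hR ℓ h0
  rw [Complex.ofReal_zero] at hne0
  rw [hφ.deriv_eq_ofReal hT hR ℓ hy, Complex.ofReal_re, ← Complex.ofReal_mul]
  congr 1
  rcases hcont.strictMonoOn_of_injOn_Ioo (by norm_num) (hφ.injOn_realBranch hT ℓ) with h | h
  · have hpos : ∀ z ∈ Ioo (-1 : ℝ) 1, 0 ≤ (deriv (φ ℓ) z).re := fun z hz =>
      (hφ.hasDerivAt_realBranch hR ℓ (Ioo_subset_Icc_self hz)).hasDerivWithinAt.nonneg_of_monotoneOn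
        (hacc z hz) h.monotoneOn
    have hp0 := hpos 0 h0
    rw [Complex.ofReal_zero] at hp0
    rw [Real.sign_of_pos (lt_of_le_of_ne hp0 hne0.symm), one_mul, abs_of_nonneg (hpos y hy)]
  · have hneg : ∀ z ∈ Ioo (-1 : ℝ) 1, (deriv (φ ℓ) z).re ≤ 0 := fun z hz =>
      (hφ.hasDerivAt_realBranch hR ℓ (Ioo_subset_Icc_self hz)).hasDerivWithinAt.nonpos_of_antitoneOn
        (hacc z hz) h.antitoneOn
    have hp0 := hneg 0 h0
    rw [Complex.ofReal_zero] at hp0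
    rw [Real.sign_of_neg (lt_of_le_of_ne hp0 hne0), abs_of_nonpos (hneg y hy)]
    ring

/-- The transfer operator is the adjoint of the composition with `T`. -/
lemma integral_pow_mul_transfer (hT : IsFullBranchMap T a b)
    (hφ : ExtendsInverseBranches T a b φ r R) (hR : 1 < R) {f : ℂ → ℂ} (hf : Continuous f)
    (j : ℕ) :
    ∫ x in (-1 : ℝ)..1, (T x : ℂ) ^ j * f x = ∫ y in (-1 : ℝ)..1, (y : ℂ) ^ j * transfer φ f y := by
  set F : ℝ → ℂ := fun x => (T x : ℂ) ^ j * f x with hF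
  have hFc : ∀ ℓ, ContinuousOn F (Ioo (a ℓ) (b ℓ)) := fun ℓ =>
    ((Complex.continuous_ofReal.comp_continuousOn (hT.continuousOn ℓ)).pow j).mul
      (hf.comp Complex.continuous_ofReal).continuousOn
  obtain ⟨C, hC⟩ := (isCompact_Icc (a := (-1 : ℝ)) (b := 1)).exists_bound_of_continuousOn
    (hf.comp Complex.continuous_ofReal).continuousOn
  have hFb : ∀ x ∈ Icc (-1 : ℝ) 1, ‖F x‖ ≤ C := fun x hx => by
    have h1 : |T x| ^ j ≤ 1 := pow_le_one₀ (abs_nonneg _) (hT.abs_le_one hx)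
    have h2 := hC x hx
    simp only [Function.comp_apply] at h2
    rw [norm_mul, norm_pow, Complex.norm_real, Real.norm_eq_abs]
    nlinarith [norm_nonneg (f x)]
  have hInt := (hT.intervalIntegrable hFc hFb).1
  have hJ : ∀ ℓ, ∀ x ∈ Ioo (-1 : ℝ) 1, HasDerivWithinAt (realBranch φ ℓ) (deriv (φ ℓ) x).re
      (Ioo (-1) 1) x := fun ℓ x hx =>
    (hφ.hasDerivAt_realBranch hR ℓ (Ioo_subset_Icc_self hx)).hasDerivWithinAt
  have hpull : ∀ ℓ, EqOn (fun y : ℝ => |(deriv (φ ℓ) y).re| • F (realBranch φ ℓ y))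
      (fun y : ℝ => (y : ℂ) ^ j * (((Real.sign (deriv (φ ℓ) 0).re : ℝ) : ℂ) * deriv (φ ℓ) y *
        f (φ ℓ y))) (Ioo (-1) 1) := by
    intro ℓ y hy
    obtain ⟨_, h2, h3⟩ := hφ.realBranch_spec hT ℓ hy
    simp only [hF]
    rw [hφ.sign_mul_deriv hT hR ℓ hy, h2, ← h3, Complex.real_smul]
    ring
  have hpullInt : ∀ ℓ, IntegrableOn (fun y : ℝ => (y : ℂ) ^ j *
      (((Real.sign (deriv (φ ℓ) 0).re : ℝ) : ℂ) * deriv (φ ℓ) y * f (φ ℓ y))) (Ioo (-1) 1) := by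
    intro ℓ
    rw [← integrableOn_congr_fun (hpull ℓ) measurableSet_Ioo,
      ← integrableOn_image_iff_integrableOn_abs_deriv_smul measurableSet_Ioo (hJ ℓ)
        (hφ.injOn_realBranch hT ℓ), hφ.image_realBranch hT ℓ]
    exact hInt ℓ
  calc ∫ x in (-1 : ℝ)..1, F x = ∫ x in ⋃ ℓ, Ioo (a ℓ) (b ℓ), F x := by
        rw [intervalIntegral.integral_of_le (by norm_num),
          setIntegral_congr_set hT.iUnion_Ioo_ae_eq]
    _ = ∑ ℓ, ∫ x in Ioo (a ℓ) (b ℓ), F x :=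
        integral_iUnion_fintype (fun _ => measurableSet_Ioo) (fun i j hij => hT.disjoint i j hij)
          hInt
    _ = ∑ ℓ, ∫ y in Ioo (-1 : ℝ) 1, (y : ℂ) ^ j *
          (((Real.sign (deriv (φ ℓ) 0).re : ℝ) : ℂ) * deriv (φ ℓ) y * f (φ ℓ y)) := by
        refine Finset.sum_congr rfl fun ℓ _ => ?_
        rw [← hφ.image_realBranch hT ℓ, integral_image_eq_integral_abs_deriv_smul
          measurableSet_Ioo (hJ ℓ) (hφ.injOn_realBranch hT ℓ)]
        exact setIntegral_congr_fun measurableSet_Ioo (hpull ℓ)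
    _ = ∫ y in (-1 : ℝ)..1, (y : ℂ) ^ j * transfer φ f y := by
        rw [intervalIntegral.integral_of_le (by norm_num), integral_Ioc_eq_integral_Ioo,
          ← integral_finsetSum _ fun ℓ _ => hpullInt ℓ]
        simp only [transfer, Finset.mul_sum]

end ExtendsInverseBranches
end EDMD
end

/-! ### Taylor coefficients -/

noncomputable section

namespace EDMD

open Metric Complex MeasureTheory
open scoped Nat Real

/-- The `k`-th Taylor coefficient of `g` at `0`. -/
def taylorCoeff (g : ℂ → ℂ) (k : ℕ) : ℂ := iteratedDeriv k g 0 / k !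

lemma hasSum_taylorCoeff {g : ℂ → ℂ} {R : ℝ} (hg : DifferentiableOn ℂ g (ball 0 R)) {z : ℂ}
    (hz : z ∈ ball (0 : ℂ) R) : HasSum (fun k => taylorCoeff g k * z ^ k) (g z) := by
  have h : (fun k => taylorCoeff g k * z ^ k) =
      fun k : ℕ => (k ! : ℂ)⁻¹ • (z - 0) ^ k • iteratedDeriv k g 0 := by
    ext k
    simp only [taylorCoeff, sub_zero, smul_eq_mul]
    ring
  exact h ▸ hasSum_taylorSeries_on_ball hg hz

lemma norm_taylorCoeff_le {g : ℂ → ℂ} {s C : ℝ} (hs : 0 < s) (hg : DiffContOnCl ℂ g (ball 0 s))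
    (hC : ∀ z ∈ sphere (0 : ℂ) s, ‖g z‖ ≤ C) (k : ℕ) : ‖taylorCoeff g k‖ ≤ C / s ^ k := by
  have h := norm_iteratedDeriv_le_of_forall_mem_sphere_norm_le k hs hg hC
  have hk : (0 : ℝ) < k ! := by exact_mod_cast Nat.factorial_pos k
  rw [taylorCoeff, norm_div, Complex.norm_natCast, div_le_iff₀ hk]
  calc _ ≤ _ := h
    _ = _ := by ring

/-- The Taylor coefficients of `g` are the Fourier coefficients of its restriction to a circle. -/
lemma circleMean_mul_conj_pow {g : ℂ → ℂ} {s : ℝ} (hs : 0 < s) (hg : DiffContOnCl ℂ g (ball 0 s))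
    (k : ℕ) :
    (1 / (2 * π) : ℂ) * ∫ t in (0 : ℝ)..(2 * π),
      g (s * exp (I * t)) * (starRingEnd ℂ) ((s * exp (I * t)) ^ k)
      = (s : ℂ) ^ (2 * k) * taylorCoeff g k := by
  lift s to NNReal using hs.le
  have h1 := hg.hasFPowerSeriesOnBall (by exact_mod_cast hs)
  have h2 := h1.analyticAt.hasFPowerSeriesAt
  have h3 := h1.hasFPowerSeriesAt.eq_formalMultilinearSeries h2
  have h4 := congrArg (fun p => p.coeff k) h3
  simp only [FormalMultilinearSeries.coeff_ofScalars] at h4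
  rw [taylorCoeff, ← h4, FormalMultilinearSeries.coeff, show (1 : Fin k → ℂ) = fun _ => 1 from rfl,
    cauchyPowerSeries_apply, circleIntegral]
  have hsc : ((s : ℝ) : ℂ) ≠ 0 := by exact_mod_cast hs.ne'
  simp only [smul_eq_mul, ← intervalIntegral.integral_const_mul]
  refine intervalIntegral.integral_congr fun t _ => ?_
  have hz : ((s : ℝ) : ℂ) * exp (I * t) ≠ 0 := mul_ne_zero hsc (exp_ne_zero _)
  have hcirc : circleMap 0 (s : ℝ) t = (s : ℝ) * exp (I * t) := by
    simp [circleMap, mul_comm]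
  have hconj : (starRingEnd ℂ) (((s : ℝ) : ℂ) * exp (I * t)) =
      ((s : ℝ) : ℂ) ^ 2 / (((s : ℝ) : ℂ) * exp (I * t)) := by
    rw [eq_div_iff hz, ← Complex.normSq_eq_conj_mul_self, Complex.normSq_eq_norm_sq, norm_mul,
      mul_comm I, Complex.norm_exp_ofReal_mul_I]
    simp
  have hpi : (π : ℂ) ≠ 0 := by exact_mod_cast Real.pi_ne_zero
  simp only [deriv_circleMap, hcirc, sub_zero, map_pow, hconj]
  rw [div_pow, div_pow, one_pow, pow_mul]
  field_simp

end EDMD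
end

/-! ### The transfer operator on the Hardy space -/

noncomputable section

namespace EDMD

open MeasureTheory Metric
open scoped Real

lemma norm_ofReal_mul_exp {s : ℝ} (hs : 0 ≤ s) (t : ℝ) :
    ‖(s : ℂ) * Complex.exp (Complex.I * t)‖ = s := by
  rw [norm_mul, mul_comm Complex.I, Complex.norm_exp_ofReal_mul_I, mul_one, Complex.norm_real,
    Real.norm_of_nonneg hs]

lemma circleMeanSq_le {f : ℂ → ℂ} {s B : ℝ} (hs : 0 ≤ s)
    (hB : ∀ z : ℂ, ‖z‖ = s → ‖f z‖ ≤ B) : circleMeanSq f s ≤ B ^ 2 := by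
  have h : ‖∫ t in (0 : ℝ)..(2 * π), ‖f (s * Complex.exp (Complex.I * t))‖ ^ 2‖ ≤
      B ^ 2 * |2 * π - 0| := by
    refine intervalIntegral.norm_integral_le_of_norm_le_const fun t _ => ?_
    rw [Real.norm_of_nonneg (by positivity)]
    have := hB _ (norm_ofReal_mul_exp hs t)
    gcongr
  rw [sub_zero, abs_of_pos Real.two_pi_pos] at h
  rw [circleMeanSq, one_div, inv_mul_le_iff₀ Real.two_pi_pos]
  exact (le_abs_self _).trans (h.trans_eq (mul_comm _ _))

lemma memHardy_of_bounded {ρ B : ℝ} (hρ : 0 < ρ) {f : ℂ → ℂ}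
    (hf : DifferentiableOn ℂ f (ball 0 ρ)) (hB : ∀ z ∈ ball (0 : ℂ) ρ, ‖f z‖ ≤ B) :
    MemHardy ρ f ∧ hardyNorm ρ f ≤ B := by
  have h0 : 0 ≤ B := (norm_nonneg _).trans (hB 0 (mem_ball_self hρ))
  have h : ∀ s ∈ Set.Ico 0 ρ, circleMeanSq f s ≤ B ^ 2 := fun s hs =>
    circleMeanSq_le hs.1 fun z hz => hB z (by rw [mem_ball_zero_iff, hz]; exact hs.2)
  refine ⟨⟨hf, B ^ 2, ?_⟩, csSup_le ⟨_, 0, ⟨le_rfl, hρ⟩, rfl⟩ ?_⟩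
  · rintro _ ⟨s, hs, rfl⟩
    exact h s hs
  · rintro _ ⟨s, hs, rfl⟩
    exact Real.sqrt_le_iff.mpr ⟨h0, h s hs⟩

lemma sqrt_circleMeanSq_le_hardyNorm {ρ s : ℝ} {f : ℂ → ℂ} (hf : MemHardy ρ f)
    (hs : s ∈ Set.Ico 0 ρ) : √(circleMeanSq f s) ≤ hardyNorm ρ f := by
  obtain ⟨C, hC⟩ := hf.2
  refine le_csSup ⟨√C, ?_⟩ ⟨s, hs, rfl⟩
  rintro _ ⟨t, ht, rfl⟩
  exact Real.sqrt_le_sqrt (hC ⟨t, ht, rfl⟩)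

/-- Point evaluations are bounded on `H²(D_ρ)`, uniformly on smaller disks; Cauchy's formula for
`f ^ 2` gives this directly in terms of the mean of `|f| ^ 2`. -/
lemma norm_le_of_memHardy {ρ r s : ℝ} (hr : 0 < r) (hrs : r < s) (hs : s < ρ) {f : ℂ → ℂ}
    (hf : MemHardy ρ f) {z : ℂ} (hz : z ∈ ball (0 : ℂ) r) :
    ‖f z‖ ≤ √(s / (s - r)) * hardyNorm ρ f := by
  have hs0 : 0 < s := hr.trans hrs
  have hd : 0 < s - r := sub_pos.mpr hrs
  have hdiff : DifferentiableOn ℂ f (closedBall 0 s) := hf.1.mono (closedBall_subset_ball hs)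
  have hcirc : ∀ t : ℝ, circleMap 0 s t = s * Complex.exp (Complex.I * t) := fun t => by
    simp [circleMap, mul_comm]
  have hcauchy := (hdiff.pow 2).diffContOnCl_ball (le_refl _)
    |>.two_pi_i_inv_smul_circleIntegral_sub_inv_smul (mem_ball_zero_iff.mpr
      ((mem_ball_zero_iff.mp hz).trans hrs))
  have hcont : Continuous fun t : ℝ => ‖f (s * Complex.exp (Complex.I * t))‖ ^ 2 := by
    refine (Continuous.norm ?_).pow 2
    exact hdiff.continuousOn.comp_continuous (by fun_prop) fun t => by
      rw [mem_closedBall_zero_iff, norm_ofReal_mul_exp hs0.le]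
  have hbound : ‖∮ w in C(0, s), (w - z)⁻¹ • (f ^ 2) w‖ ≤
      s / (s - r) * ∫ t in (0 : ℝ)..(2 * π), ‖f (s * Complex.exp (Complex.I * t))‖ ^ 2 := by
    rw [circleIntegral, ← intervalIntegral.integral_const_mul]
    refine intervalIntegral.norm_integral_le_of_norm_le Real.two_pi_pos.le
      (ae_of_all _ fun t _ => ?_) ((hcont.const_mul _).intervalIntegrable _ _)
    have h1 : s - r ≤ ‖circleMap 0 s t - z‖ := by
      have h2 : ‖circleMap 0 s t‖ = s := by simp [abs_of_pos hs0]
      have := norm_sub_norm_le (circleMap 0 s t) z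
      have := mem_ball_zero_iff.mp hz
      linarith
    rw [norm_smul, norm_smul, norm_inv, deriv_circleMap, norm_mul, Complex.norm_I, mul_one,
      norm_circleMap_zero, abs_of_pos hs0, Pi.pow_apply, norm_pow, hcirc, ← mul_assoc,
      ← div_eq_mul_inv]
    rw [hcirc] at h1
    gcongr
  have hsq : ‖f z‖ ^ 2 ≤ s / (s - r) * circleMeanSq f s := by
    have h1 : ‖f z‖ ^ 2 = (2 * π)⁻¹ * ‖∮ w in C(0, s), (w - z)⁻¹ • (f ^ 2) w‖ := by
      rw [← norm_pow, ← Pi.pow_apply f, ← hcauchy, norm_smul]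
      congr 1
      simp [abs_of_pos Real.pi_pos]
    rw [h1, circleMeanSq]
    calc _ ≤ (2 * π)⁻¹ * (s / (s - r) *
          ∫ t in (0 : ℝ)..(2 * π), ‖f (s * Complex.exp (Complex.I * t))‖ ^ 2) := by gcongr
      _ = _ := by ring
  calc ‖f z‖ ≤ √(s / (s - r) * circleMeanSq f s) := Real.le_sqrt_of_sq_le hsq
    _ = √(s / (s - r)) * √(circleMeanSq f s) := Real.sqrt_mul (by positivity) _
    _ ≤ _ := by
      gcongr
      exact sqrt_circleMeanSq_le_hardyNorm hf ⟨hs0.le, hs⟩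

namespace ExtendsInverseBranches

variable {d : ℕ} {T : ℝ → ℝ} {a b : Fin d → ℝ} {φ : Fin d → ℂ → ℂ} {r R : ℝ}

lemma differentiableOn_transfer (hφ : ExtendsInverseBranches T a b φ r R) {ρ : ℝ} (hρ : r ≤ ρ)
    {f : ℂ → ℂ} (hf : DifferentiableOn ℂ f (ball 0 ρ)) :
    DifferentiableOn ℂ (transfer φ f) (ball 0 R) := by
  refine DifferentiableOn.fun_sum fun ℓ _ => ?_
  refine (((hφ.holo ℓ).deriv isOpen_ball).const_mul _).mul (hf.comp (hφ.holo ℓ) fun z hz => ?_)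
  exact ball_subset_ball hρ (hφ.mapsTo ℓ hz)

/-- On disks smaller than `D_R` the function `𝓛 f` is bounded by the supremum of `f` on `D_r`. -/
lemma exists_norm_transfer_le (hφ : ExtendsInverseBranches T a b φ r R) {s : ℝ} (hs : s < R) :
    ∃ K > 0, ∀ (f : ℂ → ℂ) (B : ℝ), 0 ≤ B → (∀ z ∈ ball (0 : ℂ) r, ‖f z‖ ≤ B) →
      ∀ z ∈ closedBall (0 : ℂ) s, ‖transfer φ f z‖ ≤ K * B := by
  have hbd : ∀ ℓ, ∃ C, ∀ z ∈ closedBall (0 : ℂ) s, ‖deriv (φ ℓ) z‖ ≤ C := fun ℓ =>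
    (isCompact_closedBall 0 s).exists_bound_of_continuousOn
      (((hφ.holo ℓ).deriv isOpen_ball).continuousOn.mono (closedBall_subset_ball hs))
  choose C hC using hbd
  refine ⟨∑ ℓ, |C ℓ| + 1, by positivity, fun f B hB hf z hz => ?_⟩
  have hzR := closedBall_subset_ball hs hz
  calc ‖transfer φ f z‖ ≤ ∑ ℓ, |C ℓ| * B := by
        refine (norm_sum_le _ _).trans (Finset.sum_le_sum fun ℓ _ => ?_)
        have h1 : ‖((Real.sign (deriv (φ ℓ) 0).re : ℝ) : ℂ)‖ ≤ 1 := by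
          rw [Complex.norm_real]
          rcases Real.sign_apply_eq (deriv (φ ℓ) 0).re with h | h | h <;> simp [h]
        rw [norm_mul, norm_mul]
        calc _ ≤ 1 * |C ℓ| * B := by
              gcongr
              · exact (hC ℓ z hz).trans (le_abs_self _)
              · exact hf _ (hφ.mapsTo ℓ hzR)
          _ = _ := by ring
    _ ≤ _ := by rw [← Finset.sum_mul]; nlinarith

/-- The transfer operator is bounded on `H²(D_ρ)`: evaluation on `D_r` is bounded, and `𝓛` maps
functions bounded on `D_r` to functions bounded on `D_ρ`. -/
lemma exists_hardyNorm_transfer_le (hφ : ExtendsInverseBranches T a b φ r R) {ρ : ℝ} (hr : 0 < r)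
    (hrρ : r < ρ) (hρR : ρ < R) : ∃ K : ℝ, ∀ f, MemHardy ρ f →
      MemHardy ρ (transfer φ f) ∧ hardyNorm ρ (transfer φ f) ≤ K * hardyNorm ρ f := by
  obtain ⟨K, hK0, hK⟩ := hφ.exists_norm_transfer_le hρR
  obtain ⟨s, hrs, hsρ⟩ := exists_between hrρ
  refine ⟨K * √(s / (s - r)), fun f hf => ?_⟩
  have hn : 0 ≤ hardyNorm ρ f := (Real.sqrt_nonneg _).trans
    (sqrt_circleMeanSq_le_hardyNorm hf ⟨le_rfl, hr.trans hrρ⟩)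
  rw [mul_assoc]
  refine memHardy_of_bounded (hr.trans hrρ)
    ((hφ.differentiableOn_transfer hrρ.le hf.1).mono (ball_subset_ball hρR.le)) fun z hz => ?_
  exact hK f _ (by positivity) (fun w hw => norm_le_of_memHardy hr hrs hsρ hf hw) z
    (ball_subset_closedBall hz)

lemma differentiable_hardyBasis (ρ : ℝ) (l : ℕ) : Differentiable ℂ (hardyBasis ρ l) := by
  unfold hardyBasis
  fun_prop

lemma hasHardyInner_transfer (hφ : ExtendsInverseBranches T a b φ r R) {ρ : ℝ} (hρ : 0 < ρ)
    (hρR : ρ < R) (k l : ℕ) :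
    HasHardyInner ρ (transfer φ (hardyBasis ρ l)) (hardyBasis ρ k)
      ((ρ : ℂ) ^ k * taylorCoeff (transfer φ (hardyBasis ρ l)) k) := by
  have hρc : (ρ : ℂ) ≠ 0 := by exact_mod_cast hρ.ne'
  set g := transfer φ (hardyBasis ρ l) with hg
  have hgd : DifferentiableOn ℂ g (ball 0 R) :=
    hφ.differentiableOn_transfer le_rfl (differentiable_hardyBasis ρ l).differentiableOn
  have hlim : Filter.Tendsto (fun s : ℝ => ((ρ : ℂ) ^ k)⁻¹ * ((s : ℂ) ^ (2 * k) * taylorCoeff g k))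
      (nhdsWithin ρ (Set.Iio ρ)) (nhds ((ρ : ℂ) ^ k * taylorCoeff g k)) := by
    have h1 : (ρ : ℂ) ^ k * taylorCoeff g k =
        ((ρ : ℂ) ^ k)⁻¹ * ((ρ : ℂ) ^ (2 * k) * taylorCoeff g k) := by
      rw [two_mul, pow_add]; field_simp
    rw [h1]
    have : Continuous fun s : ℝ => ((ρ : ℂ) ^ k)⁻¹ * ((s : ℂ) ^ (2 * k) * taylorCoeff g k) := by
      fun_prop
    exact (this.tendsto ρ).mono_left nhdsWithin_le_nhds
  refine hlim.congr' ?_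
  filter_upwards [Ioo_mem_nhdsLT hρ] with s hs
  rw [← circleMean_mul_conj_pow hs.1 ((hgd.mono (closedBall_subset_ball
    (hs.2.trans hρR))).diffContOnCl_ball le_rfl) k, mul_left_comm,
    ← intervalIntegral.integral_const_mul]
  congr 1
  refine intervalIntegral.integral_congr fun t _ => ?_
  simp only [hardyBasis, div_pow, map_div₀, map_pow, Complex.conj_ofReal]
  field_simp

lemma exists_norm_taylorCoeff_transfer_le (hφ : ExtendsInverseBranches T a b φ r R) {ρ s : ℝ}
    (hr : 0 < r) (hρ : 0 < ρ) (hs : 0 < s) (hsR : s < R) :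
    ∃ K > 0, ∀ k l : ℕ,
      ‖taylorCoeff (transfer φ (hardyBasis ρ l)) k‖ ≤ K * (r / ρ) ^ l * s⁻¹ ^ k := by
  obtain ⟨K, hK0, hK⟩ := hφ.exists_norm_transfer_le hsR
  refine ⟨K, hK0, fun k l => ?_⟩
  have hgd : DifferentiableOn ℂ (transfer φ (hardyBasis ρ l)) (ball 0 R) :=
    hφ.differentiableOn_transfer le_rfl (differentiable_hardyBasis ρ l).differentiableOn
  have := norm_taylorCoeff_le hs ((hgd.mono (closedBall_subset_ball hsR)).diffContOnCl_ball le_rfl)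
    (C := K * (r / ρ) ^ l) (fun z hz => hK _ _ (by positivity) (fun w hw => ?_) z
      (sphere_subset_closedBall hz)) k
  · rwa [inv_pow, ← div_eq_mul_inv]
  · rw [hardyBasis, norm_pow, norm_div, Complex.norm_real, Real.norm_of_nonneg hρ.le]
    have := (mem_ball_zero_iff.mp hw).le
    gcongr

end ExtendsInverseBranches

end EDMD
end

/-! ### Matrices as operators on `ℓ²` -/

noncomputable section

namespace EDMD

lemma inner_unitVec (l : ℕ) (x : Ell2) : inner ℂ (unitVec l) x = x l := by
  rw [unitVec, lp.inner_single_left]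
  simp

lemma unitVec_apply (k l : ℕ) : unitVec l k = if k = l then 1 else 0 := by
  rw [unitVec, lp.single_apply]
  split_ifs with h
  · subst h; simp
  · simp [h]

lemma norm_unitVec (l : ℕ) : ‖unitVec l‖ = 1 := by
  rw [unitVec, lp.norm_single (by norm_num)]
  simp

lemma orthonormal_unitVec : Orthonormal ℂ unitVec := by
  rw [orthonormal_iff_ite]
  intro i j
  rw [inner_unitVec, unitVec_apply]

lemma norm_sum_smul_unitVec {N : ℕ} (c : Fin N → ℂ) :
    ‖∑ i, c i • unitVec (i : ℕ)‖ = √(∑ i, ‖c i‖ ^ 2) := by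
  have h := (orthonormal_unitVec.comp (fun i : Fin N => (i : ℕ)) Fin.val_injective).inner_sum c c
    Finset.univ
  simp only [Function.comp_apply, RCLike.conj_mul, inner_self_eq_norm_sq_to_K] at h
  rw [← Real.sqrt_sq (norm_nonneg (∑ i, c i • unitVec (i : ℕ)))]
  congr 1
  exact_mod_cast h

lemma lift_apply {N : ℕ} (A : Matrix (Fin N) (Fin N) ℂ) (x : Ell2) :
    lift A x = ∑ i : Fin N, A.mulVec (fun j => x (j : ℕ)) i • unitVec (i : ℕ) := by
  simp only [lift, _root_.sum_apply, _root_.smul_apply,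
    ContinuousLinearMap.smulRight_apply, innerSL_apply_apply, inner_unitVec, smul_smul,
    Matrix.mulVec, dotProduct, Finset.sum_smul]

lemma sum_smul_unitVec_apply {N : ℕ} (c : Fin N → ℂ) (i : Fin N) :
    (∑ j, c j • unitVec (j : ℕ) : Ell2) (i : ℕ) = c i := by
  rw [← inner_unitVec, inner_sum]
  simp [inner_smul_right, inner_unitVec, unitVec_apply, Fin.val_inj]

lemma lift_comp_lift {N : ℕ} (A B : Matrix (Fin N) (Fin N) ℂ) :
    lift A ∘L lift B = lift (A * B) := by
  ext1 x
  rw [ContinuousLinearMap.comp_apply, lift_apply A, lift_apply (A * B), lift_apply B]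
  simp only [sum_smul_unitVec_apply, Matrix.mulVec_mulVec]

lemma lift_sub {N : ℕ} (A B : Matrix (Fin N) (Fin N) ℂ) : lift (A - B) = lift A - lift B := by
  simp only [lift, Matrix.sub_apply, sub_smul, Finset.sum_sub_distrib]

/-- The operator norm is at most the sum of the norms of the columns. -/
lemma norm_lift_le {N : ℕ} (A : Matrix (Fin N) (Fin N) ℂ) :
    ‖lift A‖ ≤ ∑ j, √(∑ i, ‖A i j‖ ^ 2) := by
  refine ContinuousLinearMap.opNorm_le_bound _ (by positivity) fun x => ?_
  have h : lift A x = ∑ j : Fin N, x (j : ℕ) • ∑ i : Fin N, A i j • unitVec (i : ℕ) := by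
    rw [lift_apply]
    simp only [Matrix.mulVec, dotProduct, Finset.sum_smul, Finset.smul_sum, smul_smul]
    rw [Finset.sum_comm]
    simp only [mul_comm]
  rw [h, Finset.sum_mul]
  refine (norm_sum_le _ _).trans (Finset.sum_le_sum fun j _ => ?_)
  rw [norm_smul, norm_sum_smul_unitVec, mul_comm]
  gcongr
  exact lp.norm_apply_le_norm (by norm_num) x j

lemma hasSum_geometric_tail {q : ℝ} (h0 : 0 ≤ q) (h1 : q < 1) (N : ℕ) :
    HasSum (fun k => if N ≤ k then q ^ k else 0) (q ^ N * (1 - q)⁻¹) := by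
  rw [← hasSum_nat_add_iff' N, Finset.sum_eq_zero, sub_zero]
  · simp only [Nat.le_add_left, if_true, pow_add, mul_comm _ (q ^ N)]
    exact (hasSum_geometric_of_lt_one h0 h1).mul_left _
  · intro i hi
    rw [if_neg (not_le.mpr (Finset.mem_range.mp hi))]

/-- An infinite matrix with geometrically decaying entries defines a bounded operator, which is
approximated geometrically by its finite sections. -/
lemma exists_operator_of_geometric_decay (B : ℕ → ℕ → ℂ) {K p q : ℝ} (hp0 : 0 ≤ p) (hp1 : p < 1)
    (hq0 : 0 ≤ q) (hq1 : q < 1) (hB : ∀ k l, ‖B k l‖ ≤ K * (q ^ k * p ^ l)) :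
    ∃ L : Ell2 →L[ℂ] Ell2, (∀ k l, L (unitVec l) k = B k l) ∧
      ∀ N, ‖L - lift (fun i j : Fin N => B i j)‖ ≤
        K * (q ^ N + p ^ N) * ((1 - p)⁻¹ * (1 - q)⁻¹) := by
  obtain ⟨E, hE⟩ : ∃ E : ℕ × ℕ → (Ell2 →L[ℂ] Ell2), ∀ x, E x =
    B x.1 x.2 • (innerSL ℂ (unitVec x.2)).smulRight (unitVec x.1) := ⟨_, fun _ => rfl⟩
  have hK : 0 ≤ K := by simpa using (norm_nonneg _).trans (hB 0 0)
  have hEn : ∀ x, ‖E x‖ ≤ K * (q ^ x.1 * p ^ x.2) := fun x => by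
    simp only [hE, norm_smul, ContinuousLinearMap.norm_smulRight_apply, innerSL_apply_norm,
      norm_unitVec, mul_one]
    exact hB _ _
  have hprod : ∀ {u v : ℕ → ℝ} {s t : ℝ}, (∀ k, 0 ≤ u k) → (∀ k, 0 ≤ v k) → HasSum u s →
      HasSum v t → HasSum (fun x : ℕ × ℕ => u x.1 * v x.2) (s * t) := fun hu hv hs ht =>
    hs.mul ht (hs.summable.mul_of_nonneg ht.summable hu hv)
  have hgp := hasSum_geometric_of_lt_one hp0 hp1
  have hgq := hasSum_geometric_of_lt_one hq0 hq1
  have hsum : Summable E := Summable.of_norm_bounded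
    ((hprod (fun k => by positivity) (fun k => by positivity) hgq hgp).summable.mul_left K) hEn
  refine ⟨∑' x, E x, fun k l => ?_, fun N => ?_⟩
  · have h0 : HasSum (fun x => E x (unitVec l)) ((∑' x, E x) (unitVec l)) :=
      (ContinuousLinearMap.apply ℂ Ell2 (unitVec l)).hasSum hsum.hasSum
    have h1 : HasSum (fun x => inner ℂ (unitVec k) (E x (unitVec l)))
        (inner ℂ (unitVec k) ((∑' x, E x) (unitVec l))) := (innerSL ℂ (unitVec k)).hasSum h0
    have h2 : ∀ x : ℕ × ℕ, inner ℂ (unitVec k) (E x (unitVec l)) =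
        if x = (k, l) then B k l else 0 := by
      rintro ⟨i, j⟩
      simp only [hE, _root_.smul_apply, ContinuousLinearMap.smulRight_apply,
        innerSL_apply_apply, inner_smul_right, inner_unitVec, unitVec_apply, Prod.mk.injEq]
      by_cases hi : i = k <;> by_cases hj : j = l <;> simp [hi, hj, eq_comm]
      all_goals grind
    simp only [h2] at h1
    rw [← inner_unitVec]
    exact h1.unique (hasSum_ite_eq (k, l) (B k l))
  · have hfin : lift (fun i j : Fin N => B i j) =
        ∑ x ∈ Finset.range N ×ˢ Finset.range N, E x := by
      rw [Finset.sum_product, ← Fin.sum_univ_eq_sum_range (fun i => ∑ j ∈ Finset.range N, E (i, j))]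
      refine Finset.sum_congr rfl fun i _ => ?_
      rw [← Fin.sum_univ_eq_sum_range (fun j => E (i, j))]
      simp only [hE]
    set F : ℕ × ℕ → (Ell2 →L[ℂ] Ell2) := fun x =>
      if x ∈ Finset.range N ×ˢ Finset.range N then 0 else E x with hF
    have hFsum : HasSum F (∑' x, E x - lift (fun i j : Fin N => B i j)) := by
      rw [hfin]
      have h1 := hsum.hasSum.sub (hasSum_sum_of_ne_finset_zero
        (f := fun x => if x ∈ Finset.range N ×ˢ Finset.range N then E x else 0)
        (s := Finset.range N ×ˢ Finset.range N) fun x hx => if_neg hx)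
      rw [Finset.sum_congr rfl fun x hx => if_pos hx] at h1
      have h2 : F = fun x => E x -
          if x ∈ Finset.range N ×ˢ Finset.range N then E x else 0 := by
        funext x
        simp only [hF]
        split_ifs <;> simp
      rw [h2]
      exact h1
    have hbound := ((hprod (fun k => by split_ifs <;> positivity) (fun k => by positivity)
      (hasSum_geometric_tail hq0 hq1 N) hgp).add (hprod (fun k => by positivity)
      (fun k => by split_ifs <;> positivity) hgq (hasSum_geometric_tail hp0 hp1 N))).mul_left K
    rw [← hFsum.tsum_eq]
    refine (tsum_of_norm_bounded hbound fun x => ?_).trans_eq (by ring)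
    have hq : 0 ≤ q ^ x.1 := by positivity
    have hp : 0 ≤ p ^ x.2 := by positivity
    by_cases hx : x ∈ Finset.range N ×ˢ Finset.range N
    · simp only [hF, if_pos hx, norm_zero]
      refine mul_nonneg hK (add_nonneg ?_ ?_) <;> refine mul_nonneg ?_ ?_ <;> first
        | assumption
        | (split_ifs <;> simp [hp, hq])
    · simp only [hF, if_neg hx]
      refine (hEn x).trans (mul_le_mul_of_nonneg_left ?_ hK)
      simp only [Finset.mem_product, Finset.mem_range, not_and_or, not_lt] at hx
      rcases hx with h | h
      · rw [if_pos h]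
        have : 0 ≤ q ^ x.1 * (if N ≤ x.2 then p ^ x.2 else 0) := by split_ifs <;> positivity
        linarith
      · rw [if_pos h]
        have : 0 ≤ (if N ≤ x.1 then q ^ x.1 else 0) * p ^ x.2 := by split_ifs <;> positivity
        linarith

end EDMD
end

/-! ### Comparison of the rescaled EDMD matrix with the transfer matrix -/

noncomputable section

namespace EDMD

open MeasureTheory Metric

/-- The combined effect, on one column of the rescaled matrix, of a right hand side formed by the
moments of a function bounded by `S` and of an error with entries bounded by `η`. -/
lemma sqrt_sum_norm_sq_column_le {N : ℕ} {H : Matrix (Fin N) (Fin N) ℂ} {ε ρ S η : ℝ}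
    (hH : ∀ j k : Fin N, ‖H j k - moment (j + k)‖ ≤ ε) (hε : 2 * ε * N * gam ^ N ≤ 1)
    (hρ : 1 ≤ ρ) {f : ℝ → ℂ} (hf : ContinuousOn f (Set.Icc (-1) 1)) (hS0 : 0 ≤ S)
    (hS : ∀ x ∈ Set.Icc (-1 : ℝ) 1, ‖f x‖ ≤ S) {e : Fin N → ℂ} (hη0 : 0 ≤ η)
    (he : ∀ j, ‖e j‖ ≤ η) :
    √(∑ i : Fin N, ‖(ρ : ℂ) ^ (i : ℕ) * H⁻¹.mulVec (fun j : Fin N =>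
      (1 / 2) * (∫ x in (-1 : ℝ)..1, (x : ℂ) ^ (j : ℕ) * f x) + e j) i‖ ^ 2) ≤
      3 * ρ ^ N * ((1 + √2) ^ N * S + gam ^ N * N * η) := by
  have hdet := isUnit_det_of_close hH hε
  set t : Fin N → ℂ := fun j => (1 / 2) * ∫ x in (-1 : ℝ)..1, (x : ℂ) ^ (j : ℕ) * f x with ht
  have hinv : ∀ v : Fin N → ℂ, H.mulVec (H⁻¹.mulVec v) = v := fun v => by
    rw [Matrix.mulVec_mulVec, Matrix.mul_nonsing_inv _ hdet, Matrix.one_mulVec]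
  have h1 := sum_norm_sq_le_of_mulVec_eq_integral hH hε (u := H⁻¹.mulVec t) hf hS
    fun j => congrFun (hinv t) j
  have h2 := sum_norm_sq_le_of_mulVec_eq hH hε (hinv e)
  have h3 : ∑ j, ‖e j‖ ^ 2 ≤ N * η ^ 2 := by
    calc _ ≤ ∑ _j : Fin N, η ^ 2 := Finset.sum_le_sum fun j _ => by gcongr; exact he j
      _ = _ := by simp
  have hg : 0 < gam ^ N := pow_pos (by linarith [gam_gt_five]) _
  have hτ : gam ^ N = ((1 + √2) ^ N) ^ 2 := by rw [gam, ← pow_mul, ← pow_mul, mul_comm]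
  have hN : (N : ℝ) ≤ (N : ℝ) ^ 2 := by exact_mod_cast Nat.le_self_pow two_ne_zero N
  have hsplit : (fun j : Fin N =>
      (1 / 2) * (∫ x in (-1 : ℝ)..1, (x : ℂ) ^ (j : ℕ) * f x) + e j) = t + e := rfl
  rw [hsplit, Matrix.mulVec_add]
  refine Real.sqrt_le_iff.mpr ⟨by positivity, ?_⟩
  calc ∑ i : Fin N, ‖(ρ : ℂ) ^ (i : ℕ) * (H⁻¹.mulVec t + H⁻¹.mulVec e) i‖ ^ 2
      ≤ ∑ i : Fin N, (ρ ^ N) ^ 2 *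
          (2 * ‖H⁻¹.mulVec t i‖ ^ 2 + 2 * ‖H⁻¹.mulVec e i‖ ^ 2) := by
        refine Finset.sum_le_sum fun i _ => ?_
        rw [norm_mul, mul_pow, norm_pow, Complex.norm_real, Real.norm_of_nonneg (by linarith)]
        gcongr
        · exact i.2.le
        · have := norm_add_le (H⁻¹.mulVec t i) (H⁻¹.mulVec e i)
          calc ‖(H⁻¹.mulVec t + H⁻¹.mulVec e) i‖ ^ 2
              ≤ (‖H⁻¹.mulVec t i‖ + ‖H⁻¹.mulVec e i‖) ^ 2 := by
                rw [Pi.add_apply]; gcongr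
            _ ≤ _ := by nlinarith [sq_nonneg (‖H⁻¹.mulVec t i‖ - ‖H⁻¹.mulVec e i‖)]
    _ = (ρ ^ N) ^ 2 * (2 * ∑ i, ‖H⁻¹.mulVec t i‖ ^ 2 + 2 * ∑ i, ‖H⁻¹.mulVec e i‖ ^ 2) := by
        rw [← Finset.mul_sum, Finset.sum_add_distrib, ← Finset.mul_sum, ← Finset.mul_sum]
    _ ≤ (ρ ^ N) ^ 2 * (2 * (4 * gam ^ N * S ^ 2) +
          2 * (4 * (gam ^ N) ^ 2 * ((N : ℝ) ^ 2 * η ^ 2))) := by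
        have h4 : (N : ℝ) * η ^ 2 ≤ (N : ℝ) ^ 2 * η ^ 2 := by gcongr
        gcongr
        exact h2.trans (by gcongr; exact h3.trans h4)
    _ ≤ (ρ ^ N) ^ 2 * (9 * ((1 + √2) ^ N * S + gam ^ N * N * η) ^ 2) := by
        gcongr
        rw [add_sq, mul_pow ((1 + √2) ^ N) S, ← hτ]
        have h5 : 0 ≤ (1 + √2) ^ N * S * (gam ^ N * N * η) := by positivity
        have h6 : 0 ≤ gam ^ N * S ^ 2 := by positivity
        have h7 : 0 ≤ (gam ^ N * N * η) ^ 2 := by positivity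
        nlinarith
    _ = _ := by ring

lemma sum_fin_geometric_le {q : ℝ} (h0 : 0 ≤ q) (h1 : q < 1) (N : ℕ) :
    ∑ l : Fin N, q ^ (l : ℕ) ≤ (1 - q)⁻¹ := by
  rw [Fin.sum_univ_eq_sum_range (fun l => q ^ l)]
  exact sum_le_hasSum _ (fun i _ => by positivity) (hasSum_geometric_of_lt_one h0 h1)

lemma rpow_half_natCast {x : ℝ} (hx : 0 ≤ x) (N : ℕ) : x ^ ((N : ℝ) / 2) = √x ^ N := by
  rw [Real.sqrt_eq_rpow, ← Real.rpow_natCast, ← Real.rpow_mul hx]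
  congr 1
  ring

/-- The entries of `matG` are close to `½ ∫ T(x) ^ j x ^ l dx`. -/
lemma IsFullBranchMap.exists_norm_matG_sub_le {d : ℕ} {T : ℝ → ℝ} {a b : Fin d → ℝ}
    (hT : IsFullBranchMap T a b) : ∃ W > 0, ∀ (N M : ℕ) (δ : ℝ), 0 < M → 0 ≤ δ → δ ≤ 2 / (M : ℝ) →
      ∀ j l : Fin N, ‖matG T N M δ j l -
        (1 / 2) * ∫ x in (-1 : ℝ)..1, (T x : ℂ) ^ (j : ℕ) * (x : ℂ) ^ (l : ℕ)‖ ≤ W * N / M := by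
  obtain ⟨w, hw⟩ := hT.exists_dominating
  have hW : 0 ≤ w 1 - w (-1) :=
    (abs_nonneg _).trans (hw (-1) 1 le_rfl (by norm_num) le_rfl)
  refine ⟨w 1 - w (-1) + 2, by linarith, fun N M δ hM h0 hδ j l => ?_⟩
  have hint : IntervalIntegrable (fun x => T x ^ (j : ℕ) * x ^ (l : ℕ)) volume (-1) 1 := by
    refine (hT.intervalIntegrable (F := fun x => T x ^ (j : ℕ) * x ^ (l : ℕ)) (C := 1)
      (fun ℓ => ((hT.continuousOn ℓ).pow _).mul
      (by fun_prop)) fun x hx => ?_).2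
    rw [norm_mul, norm_pow, norm_pow]
    exact mul_le_one₀ (pow_le_one₀ (norm_nonneg _) (hT.abs_le_one hx)) (by positivity)
      (pow_le_one₀ (norm_nonneg _) (abs_le.mpr hx))
  have h := abs_riemannSum_sub_integral_le hM h0 hδ hint
    (abs_pow_mul_pow_sub_le (fun x hx => hT.abs_le_one hx) hw j l)
  have hm : (1 / 2) * ∫ x in (-1 : ℝ)..1, (T x : ℂ) ^ (j : ℕ) * (x : ℂ) ^ (l : ℕ) =
      (((1 / 2) * ∫ x in (-1 : ℝ)..1, T x ^ (j : ℕ) * x ^ (l : ℕ) : ℝ) : ℂ) := by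
    rw [Complex.ofReal_mul, ← intervalIntegral.integral_ofReal]
    push_cast
    rfl
  rw [hm, matG, ← Complex.ofReal_sub, Complex.norm_real, Real.norm_eq_abs]
  refine h.trans ?_
  have hj : ((j : ℕ) : ℝ) ≤ N := by exact_mod_cast j.2.le
  have hl : ((l : ℕ) : ℝ) ≤ N := by exact_mod_cast l.2.le
  gcongr
  nlinarith

lemma rescaledEDMD_eq_lift (T : ℝ → ℝ) (ρ : ℝ) (N M : ℕ) (δ : ℝ) :
    rescaledEDMD T ρ N M δ = lift (fun i l : Fin N => (ρ : ℂ) ^ (i : ℕ) *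
      (matH N M δ)⁻¹.mulVec (fun j => matG T N M δ j l * ((ρ : ℂ) ^ (l : ℕ))⁻¹) i) := by
  rw [rescaledEDMD, opV, opVinv, lift_comp_lift, lift_comp_lift, lift_comp_lift]
  congr 1
  ext i l
  rw [Matrix.diagonal_mul, Matrix.mul_apply]
  simp only [Matrix.mul_diagonal, Matrix.mulVec, dotProduct]

namespace ExtendsInverseBranches

variable {d : ℕ} {T : ℝ → ℝ} {a b : Fin d → ℝ} {φ : Fin d → ℂ → ℂ} {r R : ℝ}

/-- The column of index `l` of the rescaled matrix `G` consists of the moments of `𝓛 e_l`; the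
Taylor polynomial of `𝓛 e_l` contributes the Hankel matrix of the moments applied to the Taylor
coefficients. -/
lemma integral_eq_sum_moment_add (hT : IsFullBranchMap T a b)
    (hφ : ExtendsInverseBranches T a b φ r R) (hR : 1 < R) (ρ : ℝ) (N j l : ℕ) :
    (1 / 2) * (∫ x in (-1 : ℝ)..1, (T x : ℂ) ^ j * (x : ℂ) ^ l) * ((ρ : ℂ) ^ l)⁻¹ =
      ∑ k : Fin N, moment (j + k) * taylorCoeff (transfer φ (hardyBasis ρ l)) k +
      (1 / 2) * ∫ x in (-1 : ℝ)..1, (x : ℂ) ^ j * (transfer φ (hardyBasis ρ l) x -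
        ∑ k : Fin N, taylorCoeff (transfer φ (hardyBasis ρ l)) k * (x : ℂ) ^ (k : ℕ)) := by
  set g := transfer φ (hardyBasis ρ l) with hg
  have hgd : DifferentiableOn ℂ g (ball 0 R) :=
    hφ.differentiableOn_transfer le_rfl (differentiable_hardyBasis ρ l).differentiableOn
  have hgc : ContinuousOn (fun x : ℝ => g x) (Set.uIcc (-1) 1) := by
    rw [Set.uIcc_of_le (by norm_num)]
    refine hgd.continuousOn.comp Complex.continuous_ofReal.continuousOn fun x hx => ?_
    rw [mem_ball_zero_iff, Complex.norm_real]
    exact (abs_le.mpr hx).trans_lt hR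
  have h1 : (∫ x in (-1 : ℝ)..1, (T x : ℂ) ^ j * (x : ℂ) ^ l) * ((ρ : ℂ) ^ l)⁻¹ =
      ∫ x in (-1 : ℝ)..1, (x : ℂ) ^ j * g x := by
    rw [← hφ.integral_pow_mul_transfer hT hR (differentiable_hardyBasis ρ l).continuous,
      ← intervalIntegral.integral_mul_const]
    simp only [hardyBasis, div_eq_mul_inv, mul_pow, inv_pow, mul_assoc]
  have h2 : ∀ x : ℝ, (x : ℂ) ^ j * (g x - ∑ k : Fin N, taylorCoeff g k * (x : ℂ) ^ (k : ℕ)) =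
      (x : ℂ) ^ j * g x - ∑ k : Fin N, taylorCoeff g k * (x : ℂ) ^ (j + k) := fun x => by
    rw [mul_sub, Finset.mul_sum]
    simp only [pow_add, mul_left_comm]
  rw [mul_assoc, h1]
  simp_rw [h2]
  have h4 : IntervalIntegrable (fun x : ℝ => (x : ℂ) ^ j * g x) volume (-1) 1 :=
    ContinuousOn.intervalIntegrable (ContinuousOn.mul (by fun_prop) hgc)
  rw [intervalIntegral.integral_sub h4
    ((by fun_prop : Continuous _).intervalIntegrable _ _),
    intervalIntegral.integral_finsetSum fun k _ =>
      (by fun_prop : Continuous _).intervalIntegrable _ _]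
  simp only [intervalIntegral.integral_const_mul, moment]
  rw [mul_sub, Finset.mul_sum]
  have h3 : ∀ k : Fin N, 1 / 2 * (taylorCoeff g k * ∫ x in (-1 : ℝ)..1, (x : ℂ) ^ (j + k)) =
      1 / 2 * (∫ x in (-1 : ℝ)..1, (x : ℂ) ^ (j + k)) * taylorCoeff g k := fun k => by ring
  simp only [h3]
  ring

end ExtendsInverseBranches

/-- The remainder of the Taylor series on `[-1, 1]`. -/
lemma norm_sub_taylor_le {g : ℂ → ℂ} {R s B : ℝ} (hg : DifferentiableOn ℂ g (ball 0 R))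
    (hR : 1 < R) (hs : 1 < s) (hB : ∀ k, ‖taylorCoeff g k‖ ≤ B * s⁻¹ ^ k) (N : ℕ) {x : ℝ}
    (hx : x ∈ Set.Icc (-1 : ℝ) 1) :
    ‖g x - ∑ k : Fin N, taylorCoeff g k * (x : ℂ) ^ (k : ℕ)‖ ≤ B * s⁻¹ ^ N * (1 - s⁻¹)⁻¹ := by
  have hx1 : ‖(x : ℂ)‖ ≤ 1 := by rw [Complex.norm_real]; exact abs_le.mpr hx
  have h1 := (hasSum_nat_add_iff' N).mpr (hasSum_taylorCoeff hg
    (mem_ball_zero_iff.mpr (hx1.trans_lt hR)))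
  rw [← Fin.sum_univ_eq_sum_range (fun k => taylorCoeff g k * (x : ℂ) ^ k)] at h1
  have h2 := (hasSum_geometric_of_lt_one (inv_nonneg.mpr (by linarith))
    (inv_lt_one_of_one_lt₀ hs)).mul_left (B * s⁻¹ ^ N)
  refine h1.norm_le_of_bounded h2 fun k => ?_
  rw [norm_mul, norm_pow]
  calc _ ≤ (B * s⁻¹ ^ (k + N)) * 1 :=
        mul_le_mul (hB _) (pow_le_one₀ (norm_nonneg _) hx1) (by positivity)
          ((norm_nonneg _).trans (hB _))
    _ = _ := by rw [pow_add]; ring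

/-- The finite sections of the transfer matrix are approximated by the rescaled EDMD matrices. -/
lemma norm_rescaledEDMD_sub_section_le {d : ℕ} {T : ℝ → ℝ} {a b : Fin d → ℝ} {φ : Fin d → ℂ → ℂ}
    {r R ρ s K W : ℝ} (hT : IsFullBranchMap T a b) (hφ : ExtendsInverseBranches T a b φ r R)
    (hr : 0 < r) (hrρ : r < ρ) (hρ : 1 < ρ) (hs : 1 < s) (hR : 1 < R) (hK : 0 < K) (hW : 0 < W)
    (hc : ∀ k l : ℕ,
      ‖taylorCoeff (transfer φ (hardyBasis ρ l)) k‖ ≤ K * (r / ρ) ^ l * s⁻¹ ^ k)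
    {N M : ℕ} {δ : ℝ} (hM : 0 < M) (h0 : 0 ≤ δ) (hδ : δ ≤ 2 / (M : ℝ))
    (hG : ∀ j l : Fin N, ‖matG T N M δ j l -
        (1 / 2) * ∫ x in (-1 : ℝ)..1, (T x : ℂ) ^ (j : ℕ) * (x : ℂ) ^ (l : ℕ)‖ ≤ W * N / M)
    (hε : 2 * (4 * N / M) * N * gam ^ N ≤ 1) :
    ‖rescaledEDMD T ρ N M δ - lift (fun i l : Fin N =>
        (ρ : ℂ) ^ (i : ℕ) * taylorCoeff (transfer φ (hardyBasis ρ l)) i)‖ ≤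
      3 * (K * (1 - r / ρ)⁻¹ * (1 - s⁻¹)⁻¹) * (ρ * (1 + √2) / s) ^ N +
      3 * (W * (1 - ρ⁻¹)⁻¹ + 4 * (K * (1 - r / ρ)⁻¹ * (1 - s⁻¹)⁻¹)) *
        ((ρ * gam) ^ N * N ^ 2 / M) := by
  have hρ0 : 0 < ρ := by linarith
  have hs0 : 0 < s := by linarith
  have hp0 : 0 ≤ r / ρ := by positivity
  have hp1 : r / ρ < 1 := (div_lt_one hρ0).mpr hrρ
  have hi0 : 0 ≤ ρ⁻¹ := by positivity
  have hi1 : ρ⁻¹ < 1 := inv_lt_one_of_one_lt₀ hρ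
  have hsi0 : 0 ≤ s⁻¹ := by positivity
  have hsi1 : s⁻¹ < 1 := inv_lt_one_of_one_lt₀ hs
  have hgam : 0 < gam := by linarith [gam_gt_five]
  set A := (1 - s⁻¹)⁻¹ with hA
  have hA0 : 0 ≤ A := inv_nonneg.mpr (by linarith)
  set c : ℕ → ℕ → ℂ := fun k l => taylorCoeff (transfer φ (hardyBasis ρ l)) k with hcdef
  have hc : ∀ k l, ‖c k l‖ ≤ K * (r / ρ) ^ l * s⁻¹ ^ k := hc
  set H := matH N M δ with hHdef
  have hH : ∀ j k : Fin N, ‖H j k - moment (j + k)‖ ≤ 4 * N / M :=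
    norm_matH_sub_moment_le hM h0 hδ
  have hdet := isUnit_det_of_close hH hε
  have hgd : ∀ l, DifferentiableOn ℂ (transfer φ (hardyBasis ρ l)) (ball 0 R) := fun l =>
    hφ.differentiableOn_transfer le_rfl
      (ExtendsInverseBranches.differentiable_hardyBasis ρ l).differentiableOn
  -- the Taylor remainder, and the error made by the discretization
  set f : ℕ → ℝ → ℂ := fun l x => transfer φ (hardyBasis ρ l) x -
    ∑ k : Fin N, c k l * (x : ℂ) ^ (k : ℕ) with hf
  set e : Fin N → Fin N → ℂ := fun l j => (matG T N M δ j l - (1 / 2) *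
      ∫ x in (-1 : ℝ)..1, (T x : ℂ) ^ (j : ℕ) * (x : ℂ) ^ (l : ℕ)) * ((ρ : ℂ) ^ (l : ℕ))⁻¹ -
    ∑ k : Fin N, (H j k - moment (j + k)) * c k l with he
  have hcol : ∀ l : Fin N, (fun j => matG T N M δ j l * ((ρ : ℂ) ^ (l : ℕ))⁻¹) =
      H.mulVec (fun k => c k l) + fun j : Fin N =>
        (1 / 2) * (∫ x in (-1 : ℝ)..1, (x : ℂ) ^ (j : ℕ) * f l x) + e l j := by
    intro l
    ext j
    have h1 := hφ.integral_eq_sum_moment_add hT hR ρ N j l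
    simp only [he, Pi.add_apply, sub_mul, h1, Finset.sum_sub_distrib, Matrix.mulVec, dotProduct]
    ring
  have hS : ∀ (l : Fin N), ∀ x ∈ Set.Icc (-1 : ℝ) 1,
      ‖f l x‖ ≤ K * (r / ρ) ^ (l : ℕ) * s⁻¹ ^ N * A := fun l x hx =>
    norm_sub_taylor_le (hgd l) hR hs (fun k => hc k l) N hx
  have hfc : ∀ l : Fin N, ContinuousOn (f l) (Set.Icc (-1) 1) := fun l => by
    refine ContinuousOn.sub ((hgd l).continuousOn.comp Complex.continuous_ofReal.continuousOn
      fun x hx => ?_) (by fun_prop)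
    rw [mem_ball_zero_iff, Complex.norm_real]
    exact (abs_le.mpr hx).trans_lt hR
  have hη : ∀ l j : Fin N, ‖e l j‖ ≤
      W * N / M * ρ⁻¹ ^ (l : ℕ) + 4 * N / M * (K * (r / ρ) ^ (l : ℕ) * A) := by
    intro l j
    refine (norm_sub_le _ _).trans (add_le_add ?_ ?_)
    · rw [norm_mul, norm_inv, norm_pow, Complex.norm_real, Real.norm_of_nonneg hρ0.le, ← inv_pow]
      exact mul_le_mul_of_nonneg_right (hG j l) (by positivity)
    · calc _ ≤ ∑ k : Fin N, 4 * N / M * (K * (r / ρ) ^ (l : ℕ) * s⁻¹ ^ (k : ℕ)) := by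
            refine (norm_sum_le _ _).trans (Finset.sum_le_sum fun k _ => ?_)
            rw [norm_mul]
            exact mul_le_mul (hH j k) (hc k l) (norm_nonneg _) (by positivity)
        _ ≤ _ := by
            rw [← Finset.mul_sum, ← Finset.mul_sum]
            gcongr
            exact sum_fin_geometric_le hsi0 hsi1 N
  have hdiff : rescaledEDMD T ρ N M δ - lift (fun i l : Fin N => (ρ : ℂ) ^ (i : ℕ) * c i l) =
      lift (fun i l : Fin N => (ρ : ℂ) ^ (i : ℕ) * H⁻¹.mulVec (fun j : Fin N =>
        (1 / 2) * (∫ x in (-1 : ℝ)..1, (x : ℂ) ^ (j : ℕ) * f l x) + e l j) i) := by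
    rw [rescaledEDMD_eq_lift]
    refine (lift_sub _ _).symm.trans (congrArg lift (Matrix.ext fun i l => ?_))
    change (ρ : ℂ) ^ (i : ℕ) * H⁻¹.mulVec (fun j => matG T N M δ j l * ((ρ : ℂ) ^ (l : ℕ))⁻¹) i -
      (ρ : ℂ) ^ (i : ℕ) * c i l = _
    rw [← mul_sub, hcol l, Matrix.mulVec_add, Matrix.mulVec_mulVec,
      Matrix.nonsing_inv_mul _ hdet, Matrix.one_mulVec, Pi.add_apply, add_sub_cancel_left]
  rw [hdiff]
  refine (norm_lift_le _).trans ?_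
  calc _ ≤ ∑ l : Fin N, 3 * ρ ^ N * ((1 + √2) ^ N * (K * (r / ρ) ^ (l : ℕ) * s⁻¹ ^ N * A) +
          gam ^ N * N * (W * N / M * ρ⁻¹ ^ (l : ℕ) + 4 * N / M * (K * (r / ρ) ^ (l : ℕ) * A))) :=
        Finset.sum_le_sum fun l _ => sqrt_sum_norm_sq_column_le hH hε hρ.le (hfc l)
          (by positivity) (hS l) (by positivity) (hη l)
    _ = (3 * ρ ^ N * (1 + √2) ^ N * K * s⁻¹ ^ N * A +
          3 * ρ ^ N * gam ^ N * N * (4 * N / M) * K * A) * (∑ l : Fin N, (r / ρ) ^ (l : ℕ)) +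
        3 * ρ ^ N * gam ^ N * N * (W * N / M) * ∑ l : Fin N, ρ⁻¹ ^ (l : ℕ) := by
        rw [Finset.mul_sum, Finset.mul_sum, ← Finset.sum_add_distrib]
        exact Finset.sum_congr rfl fun l _ => by ring
    _ ≤ (3 * ρ ^ N * (1 + √2) ^ N * K * s⁻¹ ^ N * A +
          3 * ρ ^ N * gam ^ N * N * (4 * N / M) * K * A) * (1 - r / ρ)⁻¹ +
        3 * ρ ^ N * gam ^ N * N * (W * N / M) * (1 - ρ⁻¹)⁻¹ := by
        gcongr
        · exact sum_fin_geometric_le hp0 hp1 N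
        · exact sum_fin_geometric_le hi0 hi1 N
    _ = _ := by
        rw [div_eq_mul_inv (ρ * (1 + √2)) s, mul_pow, mul_pow, mul_pow]
        ring

/-- The relations between the radii `r < ρ < s < R`, where `s = R / √gam`, and the rates of
convergence. -/
lemma radii_relations {r R ρ : ℝ} (hr : 1 < r) (hrR : r < R) (hγ : r / R < 1 / gam)
    (hρ : ρ = √(r * R / gam)) :
    r < ρ ∧ ρ < R / (1 + √2) ∧ R / (1 + √2) < R ∧ √(gam * r / R) = r / ρ ∧
      √(gam * r / R) = ρ * (1 + √2) / (R / (1 + √2)) ∧ √(gam * r * R) = ρ * gam := by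
  have hg5 := gam_gt_five
  have hg0 : 0 < gam := by linarith
  have hr0 : 0 < r := by linarith
  have hR0 : 0 < R := by linarith
  have hsq : ρ ^ 2 = r * R / gam := by rw [hρ, Real.sq_sqrt (by positivity)]
  have hρ0 : 0 < ρ := by rw [hρ]; positivity
  have hrR' : r * gam < R := by
    rw [div_lt_div_iff₀ hR0 hg0, one_mul] at hγ
    exact hγ
  have hrρ : r < ρ := by
    refine lt_of_pow_lt_pow_left₀ 2 hρ0.le ?_
    rw [hsq, lt_div_iff₀ hg0]
    nlinarith
  have hρgR : ρ * gam < R := by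
    refine lt_of_pow_lt_pow_left₀ 2 hR0.le ?_
    rw [mul_pow, hsq, show r * R / gam * gam ^ 2 = (r * gam) * R by field_simp]
    nlinarith
  set τ : ℝ := 1 + √2 with hτ
  have hτ1 : 1 < τ := by rw [hτ]; have : 0 < √2 := by positivity
                         linarith
  have hτ0 : 0 < τ := by linarith
  have hτg : τ * τ = gam := by rw [gam, sq]
  set s : ℝ := R / τ with hs
  have hs0 : 0 < s := by positivity
  have hsR : s < R := div_lt_self hR0 hτ1
  have hρτs : ρ * τ / s = ρ * gam / R := by
    rw [hs, ← hτg]; field_simp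
  have hρs : ρ < s := by
    rw [hs, lt_div_iff₀ hτ0]
    nlinarith
  have hp0 : 0 ≤ r / ρ := by positivity
  have hx : √(gam * r / R) = r / ρ := by
    rw [Real.sqrt_eq_iff_mul_self_eq (by positivity) hp0, ← sq, div_pow, hsq]
    field_simp
  have hx' : √(gam * r / R) = ρ * τ / s := by
    rw [hρτs, Real.sqrt_eq_iff_mul_self_eq (by positivity) (by positivity), ← sq, div_pow,
      mul_pow, hsq]
    field_simp
  have hy : √(gam * r * R) = ρ * gam := by
    rw [Real.sqrt_eq_iff_mul_self_eq (by positivity) (by positivity), ← sq, mul_pow, hsq]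
    field_simp
  exact ⟨hrρ, hρs, hsR, hx, hx', hy⟩

end EDMD
end

theorem theorem1 {d : ℕ} (T : ℝ → ℝ) (a b : Fin d → ℝ) (φ : Fin d → ℂ → ℂ) (r R ρ : ℝ)
    (hT : EDMD.IsFullBranchMap T a b)
    (hr : 1 < r) (hrR : r < R)
    (hφ : EDMD.ExtendsInverseBranches T a b φ r R)
    (hγ : r / R < 1 / EDMD.gam)
    (hρ : ρ = √(r * R / EDMD.gam)) :
    ∃ L : EDMD.Ell2 →L[ℂ] EDMD.Ell2, EDMD.IsTransferMatrix φ ρ L ∧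
      ∃ C₁ > (0 : ℝ), ∃ C₂ > (0 : ℝ), ∀ (N M : ℕ) (δ : ℝ), 0 < M →
        C₁ * (N : ℝ) ^ 2 * EDMD.gam ^ N ≤ (M : ℝ) → 0 ≤ δ → δ ≤ 2 / (M : ℝ) →
          IsUnit (EDMD.matH N M δ).det ∧
          ‖EDMD.rescaledEDMD T ρ N M δ - L‖ ≤
            C₂ * ((EDMD.gam * r * R) ^ ((N : ℝ) / 2) * (N : ℝ) ^ 2 / (M : ℝ)
              + (EDMD.gam * r / R) ^ ((N : ℝ) / 2)) := by
  obtain ⟨hrρ, hρs, hsR, hx, hx', hy⟩ := EDMD.radii_relations hr hrR hγ hρ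
  have hg0 : 0 < EDMD.gam := by linarith [EDMD.gam_gt_five]
  have hr0 : 0 < r := by linarith
  have hR0 : 0 < R := by linarith
  have hR1 : 1 < R := by linarith
  have hρ0 : 0 < ρ := by linarith
  have hρ1 : 1 < ρ := by linarith
  have hτ1 : 1 ≤ 1 + √2 := by linarith [Real.sqrt_nonneg 2]
  -- the radius `s = R / √γ` leaves room for the factor `√γ ^ N` in the estimates below
  obtain ⟨s, hs⟩ : ∃ s, s = R / (1 + √2) := ⟨_, rfl⟩
  rw [← hs] at hρs hsR hx'
  have hs0 : 0 < s := by linarith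
  have hs1 : 1 < s := by linarith
  obtain ⟨K, hK0, hK⟩ := hφ.exists_norm_taylorCoeff_transfer_le hr0 hρ0 hs0 hsR
  obtain ⟨W, hW0, hW⟩ := hT.exists_norm_matG_sub_le
  have hp0 : 0 ≤ r / ρ := by positivity
  have hp1 : r / ρ < 1 := (div_lt_one hρ0).mpr hrρ
  have hq0 : 0 ≤ ρ / s := by positivity
  have hq1 : ρ / s < 1 := (div_lt_one hs0).mpr hρs
  obtain ⟨L, hLe, hL⟩ := EDMD.exists_operator_of_geometric_decay
    (fun k l => (ρ : ℂ) ^ k * EDMD.taylorCoeff (EDMD.transfer φ (EDMD.hardyBasis ρ l)) k)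
    (K := K) hp0 hp1 hq0 hq1 fun k l => by
      rw [norm_mul, norm_pow, Complex.norm_real, Real.norm_of_nonneg hρ0.le, div_pow ρ s,
        div_eq_mul_inv (ρ ^ k), ← inv_pow]
      calc _ ≤ ρ ^ k * (K * (r / ρ) ^ l * s⁻¹ ^ k) := by gcongr; exact hK k l
        _ = _ := by ring
  refine ⟨L, ⟨hφ.exists_hardyNorm_transfer_le hr0 hrρ (hρs.trans hsR), fun k l => ?_⟩, 8,
    by norm_num, ?_⟩
  · rw [hLe]
    exact hφ.hasHardyInner_transfer hρ0 (hρs.trans hsR) k l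
  have hP : 0 < (1 - r / ρ)⁻¹ := inv_pos.mpr (by linarith)
  have hQ : 0 < (1 - ρ / s)⁻¹ := inv_pos.mpr (by linarith)
  have hA : 0 < (1 - s⁻¹)⁻¹ := inv_pos.mpr (by linarith [inv_lt_one_of_one_lt₀ hs1])
  have hI : 0 < (1 - ρ⁻¹)⁻¹ := inv_pos.mpr (by linarith [inv_lt_one_of_one_lt₀ hρ1])
  set c₁ := K * (1 - r / ρ)⁻¹ * (1 - s⁻¹)⁻¹ with hc₁
  set c₂ := W * (1 - ρ⁻¹)⁻¹ + 4 * c₁ with hc₂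
  set c₃ := 2 * K * ((1 - r / ρ)⁻¹ * (1 - ρ / s)⁻¹) with hc₃
  have hc₁0 : 0 < c₁ := by positivity
  have hc₂0 : 0 < c₂ := by positivity
  have hc₃0 : 0 < c₃ := by positivity
  refine ⟨3 * c₁ + 3 * c₂ + c₃, by positivity, fun N M δ hM hMN h0 hδ => ?_⟩
  have hM' : (0 : ℝ) < M := by exact_mod_cast hM
  have hε : 2 * (4 * N / M) * N * EDMD.gam ^ N ≤ (1 : ℝ) := by
    rw [show 2 * (4 * N / M) * N * EDMD.gam ^ N = 8 * (N : ℝ) ^ 2 * EDMD.gam ^ N / M by ring,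
      div_le_one hM']
    exact hMN
  refine ⟨EDMD.isUnit_det_of_close (EDMD.norm_matH_sub_moment_le hM h0 hδ) hε, ?_⟩
  rw [EDMD.rpow_half_natCast (by positivity), EDMD.rpow_half_natCast (by positivity), hy]
  have h1 := EDMD.norm_rescaledEDMD_sub_section_le hT hφ hr0 hrρ hρ1 hs1 hR1 hK0 hW0 hK hM h0 hδ
    (hW N M δ hM h0 hδ) hε
  have h2 := hL N
  rw [← hx', ← hc₁, ← hc₂] at h1
  rw [norm_sub_rev] at h2
  have h3 : (ρ / s) ^ N ≤ √(EDMD.gam * r / R) ^ N := by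
    rw [hx']
    gcongr
    exact le_mul_of_one_le_right hρ0.le hτ1
  have h4 : (r / ρ) ^ N = √(EDMD.gam * r / R) ^ N := by rw [hx]
  rw [h4] at h2
  have hX0 : 0 ≤ √(EDMD.gam * r / R) ^ N := by positivity
  have hY0 : 0 ≤ (ρ * EDMD.gam) ^ N * (N : ℝ) ^ 2 / M := by positivity
  generalize √(EDMD.gam * r / R) ^ N = X at *
  generalize (ρ * EDMD.gam) ^ N * (N : ℝ) ^ 2 / M = Y at *
  have h5 : K * ((ρ / s) ^ N + X) * ((1 - r / ρ)⁻¹ * (1 - ρ / s)⁻¹) ≤ c₃ * X :=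
    calc _ ≤ K * (X + X) * ((1 - r / ρ)⁻¹ * (1 - ρ / s)⁻¹) := by gcongr
      _ = _ := by rw [hc₃]; ring
  refine (norm_sub_le_norm_sub_add_norm_sub _ _ _).trans ((add_le_add h1 (h2.trans h5)).trans ?_)
  nlinarith [mul_nonneg hc₁0.le hY0, mul_nonneg hc₂0.le hX0, mul_nonneg hc₃0.le hY0]
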